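/- **Theorem 5.1.** Let $(X,d,\mu)$ be a complete metric measure space ($\mu$ a Borel measure), let $\Omega\subset X$ be a bounded domain (nonempty, open, connected), let $\mathcal H$ be a $\sigma$-finite Borel regular measure on $\partial\Omega$, let $V$ be a Banach space, and let $\theta>1$. Suppose that $\Omega$ is weakly $\theta$-admissible, that is: * $\mu$ is doubling on $\Omega$: there is $C_d\ge 1$ with $0<\mu(B(x,2r)\cap\Omega)\le C_d\,\mu(B(x,r)\cap\Omega)<\infty$ for all $x\in\overline\Omega$ and $r>0$; * $\mathcal H$ is upper codimension-$\theta$ regular on $\partial\Omega$: there is a constant $C$ with $\mathcal H(B(x,r)\cap\partial\Omega)\le C\,r^{-\theta}\mu(B(x,r)\cap\Omega)$ for all $x\in\partial\Omega$ and $0<r<2\operatorname{diam}\Omega$; * $\Omega$ supports a local $\theta$-Poincaré inequality: there are $C>0$ and $\lambda\ge1$ such that $$\frac1{\mu(B)}\int_{B}|u-u_{B}|\,d\mu\le C\,r\Big(\frac1{\mu(B')}\int_{B'}g^\theta\,d\mu\Big)^{1/\theta},\qquad B=B(x,r)\cap\Omega,\quad B'=B(x,\lambda r)\cap\Omega,\quad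 u_B=\frac1{\mu(B)}\int_B u\,d\mu,$$ for all $x\in\Omega$, $r>0$, every $u\in L^1_{\rm loc}(\Omega)$ (real valued, integrable on $B$) and every upper gradient $g$ of $u$ in $\Omega$. Here a Borel function $g:\Omega\to[0,\infty]$ is an upper gradient of $u$ if $d(u(\gamma(b)),u(\gamma(a)))\le\int_\gamma g\,ds$ for every rectifiable curve $\gamma:[a,b]\to\Omega$. Given a measure $\nu$, it is a $\theta$-weak upper gradient if this holds for all rectifiable curves in $\Omega$ outside a family of $\theta$-modulus zero with respect to $\nu$. Let $\omega:(0,\infty)\to[1,\infty)$ be non-increasing, put $\rho(x)=\omega(\operatorname{dist}(x,\partial\Omega))$ for $x\in\Omega$, and assume $$\int_0^1 t^{-1}\omega(t)^{-1/\theta}\,dt<\infty .$$ Let $N^{1,\theta}(\Omega,V,\rho\mu)$ be the space of all $u\in L^\theta(\Omega,V,\rho\mu)$ having an upper gradient in $L^\theta(\Omega,\rho\mu)$, normed by $\|u\|_{L^\theta(\Omega,V,\rho\mu)}+\inf_g\|g\|_{L^\theta(\Omega,\rho\mu)}$, where the infimum runs over all $\theta$-weak upper gradients $g$ of $u$ with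 respect to $\rho\mu$, functions at distance zero being identified. Then for every $u\in N^{1,\theta}(\Omega,V,\rho\mu)$ the trace $Tu(x)\in V$, defined by $$\lim_{r\to0^+}\frac1{\mu(B(x,r)\cap\Omega)}\int_{B(x,r)\cap\Omega}|u-Tu(x)|\,d\mu=0,$$ exists for $\mathcal H$-almost every $x\in\partial\Omega$, and the trace operator $$T:N^{1,\theta}(\Omega,V,\rho\mu)\to L^\theta(\partial\Omega,V,\mathcal H)$$ is a well-defined bounded linear operator. -/

import Mathlib

open MeasureTheory Set Filter Topology
open scoped ENNReal NNReal

noncomputable section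

/-- A rectifiable curve in `Ω`: a continuous map `[a, b] → Ω` of finite length
(the values of `toFun` outside `[a, b]` are irrelevant). -/
structure RectifiableCurve {X : Type*} [MetricSpace X] (Ω : Set X) where
  a : ℝ
  b : ℝ
  le : a ≤ b
  toFun : ℝ → X
  continuousOn : ContinuousOn toFun (Icc a b)
  mapsTo : MapsTo toFun (Icc a b) Ω
  rectifiable : eVariationOn toFun (Icc a b) ≠ ∞

namespace RectifiableCurve

variable {X : Type*} [MetricSpace X] {Ω : Set X}

/-- The length of a rectifiable curve. -/
def length (γ : RectifiableCurve Ω) : ℝ :=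
  (eVariationOn γ.toFun (Icc γ.a γ.b)).toReal

/-- The arc-length parametrization `[0, length γ] → Ω` of a rectifiable curve. -/
def arcParam (γ : RectifiableCurve Ω) : ℝ → X :=
  naturalParameterization γ.toFun (Icc γ.a γ.b) γ.a

/-- The line integral `∫_γ g ds` of `g : Ω → [0, ∞]`, taken along the arc-length
parametrization. -/
def lineIntegral (γ : RectifiableCurve Ω) (g : X → ℝ≥0∞) : ℝ≥0∞ :=
  ∫⁻ s in Icc 0 γ.length, g (γ.arcParam s)

/-- The arc-length function of a rectifiable curve is continuous. -/
theorem continuousOn_arcLength (γ : RectifiableCurve Ω) :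
    ContinuousOn (variationOnFromTo γ.toFun (Icc γ.a γ.b) γ.a) (Icc γ.a γ.b) := by
  have hb : BoundedVariationOn γ.toFun (Icc γ.a γ.b) := γ.rectifiable
  intro x hx
  have h1 := hb.tendsto_eVariationOn_Icc_zero_right x
    ((γ.continuousOn x hx).mono inter_subset_left)
  have h2 := hb.tendsto_eVariationOn_Icc_zero_left
    ((γ.continuousOn x hx).mono inter_subset_left)
  have h3 := (ENNReal.tendsto_toReal ENNReal.zero_ne_top).comp h1
  have h4 := (ENNReal.tendsto_toReal ENNReal.zero_ne_top).comp h2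
  have h5 := h3.add h4
  rw [ENNReal.toReal_zero, add_zero] at h5
  rw [ContinuousWithinAt, tendsto_iff_dist_tendsto_zero]
  refine squeeze_zero' (Eventually.of_forall fun _ => dist_nonneg) ?_ h5
  filter_upwards [self_mem_nhdsWithin] with y hy
  have h6 := variationOnFromTo.add hb.locallyBoundedVariationOn (left_mem_Icc.2 γ.le) hx hy
  rw [Real.dist_eq, ← h6, add_sub_cancel_left]
  simp only [Function.comp]
  rcases le_total x y with h | h
  · rw [variationOnFromTo.eq_of_le _ _ h, abs_of_nonneg ENNReal.toReal_nonneg]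
    exact le_add_of_nonneg_right ENNReal.toReal_nonneg
  · rw [variationOnFromTo.eq_of_ge _ _ h, abs_neg, abs_of_nonneg ENNReal.toReal_nonneg]
    exact le_add_of_nonneg_left ENNReal.toReal_nonneg

theorem Icc_length_subset (γ : RectifiableCurve Ω) :
    Icc 0 γ.length ⊆
      variationOnFromTo γ.toFun (Icc γ.a γ.b) γ.a '' Icc γ.a γ.b := by
  have h := intermediate_value_Icc γ.le γ.continuousOn_arcLength
  rw [variationOnFromTo.self, variationOnFromTo.eq_of_le _ _ γ.le, inter_self] at h
  exact h

theorem continuousOn_arcParam (γ : RectifiableCurve Ω) :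
    ContinuousOn γ.arcParam (Icc 0 γ.length) := by
  have hb : BoundedVariationOn γ.toFun (Icc γ.a γ.b) := γ.rectifiable
  have hu := has_unit_speed_naturalParameterization γ.toFun
    hb.locallyBoundedVariationOn (left_mem_Icc.2 γ.le)
  have hl : LipschitzOnWith 1 γ.arcParam (Icc 0 γ.length) := by
    have key : ∀ x ∈ Icc 0 γ.length, ∀ y ∈ Icc 0 γ.length, x ≤ y →
        edist (γ.arcParam x) (γ.arcParam y) ≤ edist x y := by
      intro x hx y hy hxy
      have hx' := γ.Icc_length_subset hx
      have hy' := γ.Icc_length_subset hy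
      have h1 := hu hx' hy'
      refine (eVariationOn.edist_le _ (s := _ ∩ Icc x y) ⟨hx', left_mem_Icc.2 hxy⟩
        ⟨hy', right_mem_Icc.2 hxy⟩).trans ?_
      rw [arcParam, h1, edist_comm, edist_dist, Real.dist_eq, abs_of_nonneg (by linarith)]
      simp
    intro x hx y hy
    rw [ENNReal.coe_one, one_mul]
    rcases le_total x y with h | h
    · exact key x hx y hy h
    · rw [edist_comm, edist_comm x]
      exact key y hy x hx h
  exact hl.continuousOn

theorem lineIntegral_add [MeasurableSpace X] [BorelSpace X] (γ : RectifiableCurve Ω) {g : X → ℝ≥0∞} (hg : Measurable g)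
    (h : X → ℝ≥0∞) :
    γ.lineIntegral (fun x => g x + h x) = γ.lineIntegral g + γ.lineIntegral h :=
  lintegral_add_left'
    (hg.comp_aemeasurable (γ.continuousOn_arcParam.aemeasurable measurableSet_Icc)) _

theorem lineIntegral_const_mul (γ : RectifiableCurve Ω) (c : ℝ≥0) (g : X → ℝ≥0∞) :
    γ.lineIntegral (fun x => c * g x) = c * γ.lineIntegral g :=
  lintegral_const_mul' _ _ ENNReal.coe_ne_top

theorem lineIntegral_mono (γ : RectifiableCurve Ω) {g h : X → ℝ≥0∞} (hgh : g ≤ h) :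
    γ.lineIntegral g ≤ γ.lineIntegral h :=
  lintegral_mono fun _ => hgh _

end RectifiableCurve

section Sobolev

set_option linter.unusedSectionVars false

variable {X : Type*} [MetricSpace X] [MeasurableSpace X]
variable {Z : Type*} [PseudoEMetricSpace Z]
variable {V : Type*} [NormedAddCommGroup V] [NormedSpace ℝ V]

/-- The `p`-modulus, with respect to the measure `ν` on `Ω`, of a family `Γ` of rectifiable
curves in `Ω`. -/
def curveModulus (Ω : Set X) (p : ℝ) (ν : Measure X) (Γ : Set (RectifiableCurve Ω)) : ℝ≥0∞ :=
  ⨅ (h : X → ℝ≥0∞) (_ : Measurable h) (_ : ∀ γ ∈ Γ, 1 ≤ γ.lineIntegral h),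
    ∫⁻ x in Ω, h x ^ p ∂ν

/-- The Borel function `g` is an upper gradient of `u` in `Ω`. Only the values of `u` and `g`
in `Ω` matter. -/
def IsUpperGradient (Ω : Set X) (u : X → Z) (g : X → ℝ≥0∞) : Prop :=
  Measurable g ∧ ∀ γ : RectifiableCurve Ω,
    edist (u (γ.toFun γ.b)) (u (γ.toFun γ.a)) ≤ γ.lineIntegral g

/-- The Borel function `g` is a `p`-weak upper gradient of `u` in `Ω`: the upper gradient
inequality holds for all rectifiable curves outside a family of `p`-modulus zero. -/
def IsWeakUpperGradient (Ω : Set X) (p : ℝ) (ν : Measure X) (u : X → Z) (g : X → ℝ≥0∞) : Prop :=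
  Measurable g ∧ curveModulus Ω p ν {γ : RectifiableCurve Ω |
    ¬ edist (u (γ.toFun γ.b)) (u (γ.toFun γ.a)) ≤ γ.lineIntegral g} = 0

/-- The Dirichlet seminorm `inf_g ‖g‖_{L^p(Ω, ν)}`, the infimum being taken over all `p`-weak
upper gradients `g` of `u` in `Ω`. -/
def dirichletSeminorm (Ω : Set X) (p : ℝ) (ν : Measure X) (u : X → V) : ℝ≥0∞ :=
  ⨅ (g : X → ℝ≥0∞) (_ : IsWeakUpperGradient Ω p ν u g), (∫⁻ x in Ω, g x ^ p ∂ν) ^ (1 / p)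

theorem curveModulus_mono {Ω : Set X} {p : ℝ} {ν : Measure X}
    {Γ Γ' : Set (RectifiableCurve Ω)} (h : Γ ⊆ Γ') :
    curveModulus Ω p ν Γ ≤ curveModulus Ω p ν Γ' :=
  iInf_mono fun _ => iInf_mono fun _ => iInf_mono' fun hf => ⟨fun γ hγ => hf γ (h hγ), le_rfl⟩

theorem curveModulus_union_eq_zero {Ω : Set X} {p : ℝ} {ν : Measure X}
    {Γ Γ' : Set (RectifiableCurve Ω)} (h : curveModulus Ω p ν Γ = 0)
    (h' : curveModulus Ω p ν Γ' = 0) : curveModulus Ω p ν (Γ ∪ Γ') = 0 := by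
  refine le_antisymm (ENNReal.le_of_forall_pos_le_add fun ε hε _ => ?_) zero_le
  have hε2 : (0 : ℝ≥0∞) < ε / 2 := ENNReal.half_pos (by exact_mod_cast hε.ne')
  have h1 := h.trans_lt hε2
  have h2 := h'.trans_lt hε2
  simp only [curveModulus, iInf_lt_iff] at h1 h2
  obtain ⟨f, hfm, hf, hfl⟩ := h1
  obtain ⟨f', hfm', hf', hfl'⟩ := h2
  have hle : curveModulus Ω p ν (Γ ∪ Γ') ≤ ∫⁻ x in Ω, max (f x) (f' x) ^ p ∂ν := by
    refine iInf_le_of_le (fun x => max (f x) (f' x)) ?_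
    refine iInf_le_of_le (hfm.max hfm') (iInf_le_of_le ?_ le_rfl)
    rintro γ (hγ | hγ)
    · exact (hf γ hγ).trans (γ.lineIntegral_mono fun x => le_max_left _ _)
    · exact (hf' γ hγ).trans (γ.lineIntegral_mono fun x => le_max_right _ _)
  refine hle.trans ?_
  calc ∫⁻ x in Ω, max (f x) (f' x) ^ p ∂ν
        ≤ ∫⁻ x in Ω, (f x ^ p + f' x ^ p) ∂ν := by
          refine lintegral_mono fun x => ?_
          rcases le_total (f x) (f' x) with hx | hx
          · simp [max_eq_right hx]
          · simp [max_eq_left hx]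
      _ = (∫⁻ x in Ω, f x ^ p ∂ν) + ∫⁻ x in Ω, f' x ^ p ∂ν :=
          lintegral_add_left (hfm.pow_const p) _
      _ ≤ ε / 2 + ε / 2 := add_le_add hfl.le hfl'.le
      _ = 0 + ε := by rw [ENNReal.add_halves, zero_add]

theorem IsUpperGradient.isWeakUpperGradient {Ω : Set X} {p : ℝ} (hp : 0 < p) {ν : Measure X}
    {u : X → Z} {g : X → ℝ≥0∞} (h : IsUpperGradient Ω u g) : IsWeakUpperGradient Ω p ν u g := by
  refine ⟨h.1, le_antisymm ?_ zero_le⟩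
  refine iInf_le_of_le (fun _ => 0) <| iInf_le_of_le measurable_const <| iInf_le_of_le ?_ ?_
  · intro γ hγ
    exact absurd (h.2 γ) hγ
  · simp [ENNReal.zero_rpow_of_pos hp]

theorem edist_smul_le_of {u v : V} {c : ℝ} {I : ℝ≥0∞} (h : edist u v ≤ I) :
    edist (c • u) (c • v) ≤ ‖c‖₊ * I := by
  rw [edist_eq_enorm_sub, ← smul_sub, enorm_smul, ← edist_eq_enorm_sub]
  exact mul_le_mul_right h _

variable [BorelSpace X]

theorem IsUpperGradient.add {Ω : Set X} {u v : X → V} {g h : X → ℝ≥0∞}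
    (hu : IsUpperGradient Ω u g) (hv : IsUpperGradient Ω v h) :
    IsUpperGradient Ω (u + v) (fun x => g x + h x) := by
  refine ⟨hu.1.add hv.1, fun γ => ?_⟩
  rw [γ.lineIntegral_add hu.1]
  exact (edist_add_add_le _ _ _ _).trans (add_le_add (hu.2 γ) (hv.2 γ))

theorem IsUpperGradient.const_smul {Ω : Set X} {u : X → V} {g : X → ℝ≥0∞}
    (hu : IsUpperGradient Ω u g) (c : ℝ) :
    IsUpperGradient Ω (c • u) (fun x => ‖c‖₊ * g x) := by
  refine ⟨hu.1.const_mul _, fun γ => ?_⟩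
  rw [γ.lineIntegral_const_mul]
  exact edist_smul_le_of (hu.2 γ)

theorem IsUpperGradient.zero {Ω : Set X} : IsUpperGradient Ω (0 : X → V) (fun _ => 0) :=
  ⟨measurable_const, fun γ => by simp⟩

theorem IsWeakUpperGradient.add {Ω : Set X} {p : ℝ} {ν : Measure X} {u v : X → V}
    {g h : X → ℝ≥0∞} (hu : IsWeakUpperGradient Ω p ν u g) (hv : IsWeakUpperGradient Ω p ν v h) :
    IsWeakUpperGradient Ω p ν (u + v) (fun x => g x + h x) := by
  refine ⟨hu.1.add hv.1, le_antisymm ?_ zero_le⟩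
  refine (curveModulus_mono ?_).trans (curveModulus_union_eq_zero hu.2 hv.2).le
  intro γ hγ
  by_contra hn
  simp only [mem_union, Set.mem_ofPred_eq, not_or, not_not] at hn
  apply hγ
  rw [γ.lineIntegral_add hu.1]
  exact (edist_add_add_le _ _ _ _).trans (add_le_add hn.1 hn.2)

theorem IsWeakUpperGradient.const_smul {Ω : Set X} {p : ℝ} {ν : Measure X} {u : X → V}
    {g : X → ℝ≥0∞} (hu : IsWeakUpperGradient Ω p ν u g) (c : ℝ) :
    IsWeakUpperGradient Ω p ν (c • u) (fun x => ‖c‖₊ * g x) := by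
  refine ⟨hu.1.const_mul _, le_antisymm ?_ zero_le⟩
  refine (curveModulus_mono ?_).trans hu.2.le
  intro γ hγ hn
  apply hγ
  rw [γ.lineIntegral_const_mul]
  exact edist_smul_le_of hn

theorem dirichletSeminorm_add_le {Ω : Set X} {p : ℝ} (hp : 1 ≤ p) {ν : Measure X} (u v : X → V) :
    dirichletSeminorm Ω p ν (u + v) ≤ dirichletSeminorm Ω p ν u + dirichletSeminorm Ω p ν v := by
  refine ENNReal.le_of_forall_pos_le_add fun ε hε hfin => ?_
  have hε2 : (ε / 2 : ℝ≥0∞) ≠ 0 := (ENNReal.half_pos (by exact_mod_cast hε.ne')).ne'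
  have h1 := ENNReal.lt_add_right (lt_of_le_of_lt le_self_add hfin).ne hε2
  have h2 := ENNReal.lt_add_right (lt_of_le_of_lt le_add_self hfin).ne hε2
  nth_rewrite 1 [dirichletSeminorm] at h1
  nth_rewrite 1 [dirichletSeminorm] at h2
  simp only [iInf_lt_iff] at h1 h2
  obtain ⟨g, hg, hgl⟩ := h1
  obtain ⟨h, hh, hhl⟩ := h2
  calc dirichletSeminorm Ω p ν (u + v)
      ≤ (∫⁻ x in Ω, (g x + h x) ^ p ∂ν) ^ (1 / p) :=
        iInf₂_le _ (hg.add hh)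
    _ ≤ (∫⁻ x in Ω, g x ^ p ∂ν) ^ (1 / p) + (∫⁻ x in Ω, h x ^ p ∂ν) ^ (1 / p) :=
        ENNReal.lintegral_Lp_add_le hg.1.aemeasurable hh.1.aemeasurable hp
    _ ≤ (dirichletSeminorm Ω p ν u + ε / 2) + (dirichletSeminorm Ω p ν v + ε / 2) :=
        add_le_add hgl.le hhl.le
    _ = dirichletSeminorm Ω p ν u + dirichletSeminorm Ω p ν v + ε := by
        rw [add_add_add_comm, ENNReal.add_halves]

theorem lintegral_const_mul_rpow {Ω : Set X} {p : ℝ} (hp : 0 < p) {ν : Measure X} (c : ℝ≥0)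
    (g : X → ℝ≥0∞) :
    (∫⁻ x in Ω, (c * g x) ^ p ∂ν) ^ (1 / p) = c * (∫⁻ x in Ω, g x ^ p ∂ν) ^ (1 / p) := by
  simp_rw [ENNReal.mul_rpow_of_nonneg _ _ hp.le]
  rw [lintegral_const_mul' _ _ (ENNReal.rpow_ne_top_of_nonneg hp.le ENNReal.coe_ne_top),
    ENNReal.mul_rpow_of_nonneg _ _ (by positivity), ← ENNReal.rpow_mul,
    mul_one_div_cancel hp.ne', ENNReal.rpow_one]

theorem dirichletSeminorm_smul_le {Ω : Set X} {p : ℝ} (hp : 0 < p) {ν : Measure X} (c : ℝ)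
    (u : X → V) :
    dirichletSeminorm Ω p ν (c • u) ≤ ‖c‖₊ * dirichletSeminorm Ω p ν u := by
  conv_rhs => rw [dirichletSeminorm]
  have hfin : ((‖c‖₊ : ℝ≥0) : ℝ≥0∞) ≠ ∞ := ENNReal.coe_ne_top
  rcases eq_or_ne c 0 with rfl | hc
  · have h0 : dirichletSeminorm Ω p ν ((0 : ℝ) • u) ≤ 0 := by
      rw [zero_smul]
      refine (iInf₂_le _ (IsUpperGradient.zero.isWeakUpperGradient hp)).trans ?_
      simp [ENNReal.zero_rpow_of_pos hp, hp]
    exact h0.trans zero_le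
  · have hc0 : ((‖c‖₊ : ℝ≥0) : ℝ≥0∞) ≠ 0 := by simpa using hc
    simp_rw [ENNReal.mul_iInf_of_ne hc0 hfin]
    refine le_iInf₂ fun g hg => ?_
    rw [← lintegral_const_mul_rpow hp]
    exact iInf₂_le _ (hg.const_smul c)

/-- The functions `u ∈ L^p(Ω, V, ν)` that have an upper gradient in `L^p(Ω, ν)`. -/
def preSobolevSubmodule (Ω : Set X) (V : Type*) [NormedAddCommGroup V] [NormedSpace ℝ V]
    (p : ℝ) [hp : Fact (1 ≤ p)] (ν : Measure X) : Submodule ℝ (X → V) where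
  carrier := {u | MemLp u (ENNReal.ofReal p) (ν.restrict Ω) ∧
    ∃ g, IsUpperGradient Ω u g ∧ ∫⁻ x in Ω, g x ^ p ∂ν < ∞}
  zero_mem' := ⟨MemLp.zero, fun _ => 0, IsUpperGradient.zero, by
    simp [ENNReal.zero_rpow_of_pos (zero_lt_one.trans_le hp.out)]⟩
  add_mem' := by
    rintro u v ⟨hu, g, hg, hgf⟩ ⟨hv, h, hh, hhf⟩
    exact ⟨hu.add hv, _, hg.add hh,
      ENNReal.lintegral_rpow_add_lt_top_of_lintegral_rpow_lt_top hg.1.aemeasurable hgf hhf hp.out⟩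
  smul_mem' := by
    rintro c u ⟨hu, g, hg, hgf⟩
    have hp0 : 0 < p := zero_lt_one.trans_le hp.out
    refine ⟨hu.const_smul c, _, hg.const_smul c, ?_⟩
    simp_rw [ENNReal.mul_rpow_of_nonneg _ _ hp0.le]
    rw [lintegral_const_mul' _ _ (ENNReal.rpow_ne_top_of_nonneg hp0.le ENNReal.coe_ne_top)]
    exact ENNReal.mul_lt_top (ENNReal.rpow_lt_top_of_nonneg hp0.le ENNReal.coe_ne_top) hgf

/-- The space `Ñ^{1,p}(Ω, V, ν)` of everywhere defined functions `u ∈ L^p(Ω, V, ν)` having an upper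
gradient in `L^p(Ω, ν)`, seminormed by `‖u‖_{L^p(Ω, V, ν)} + inf_g ‖g‖_{L^p(Ω, ν)}`.
Its elements are represented by functions on `X`, whose values outside `Ω` are irrelevant. -/
def PreSobolev (Ω : Set X) (V : Type*) [NormedAddCommGroup V] [NormedSpace ℝ V]
    (p : ℝ) [Fact (1 ≤ p)] (ν : Measure X) : Type _ :=
  preSobolevSubmodule Ω V p ν

namespace PreSobolev

variable {Ω : Set X} {p : ℝ} [hp : Fact (1 ≤ p)] {ν : Measure X}

instance : AddCommGroup (PreSobolev Ω V p ν) :=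
  inferInstanceAs (AddCommGroup (preSobolevSubmodule Ω V p ν))

instance : Module ℝ (PreSobolev Ω V p ν) :=
  inferInstanceAs (Module ℝ (preSobolevSubmodule Ω V p ν))

/-- The function underlying an element of `Ñ^{1,p}(Ω, V, ν)`. -/
def toFun (u : PreSobolev Ω V p ν) : X → V := u.1

instance : Norm (PreSobolev Ω V p ν) where
  norm u := (eLpNorm u.toFun (ENNReal.ofReal p) (ν.restrict Ω)).toReal +
    (dirichletSeminorm Ω p ν u.toFun).toReal

theorem norm_def (u : PreSobolev Ω V p ν) :
    ‖u‖ = (eLpNorm u.toFun (ENNReal.ofReal p) (ν.restrict Ω)).toReal +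
      (dirichletSeminorm Ω p ν u.toFun).toReal := rfl

theorem dirichletSeminorm_ne_top (u : PreSobolev Ω V p ν) :
    dirichletSeminorm Ω p ν u.toFun ≠ ∞ := by
  have hp0 : 0 < p := zero_lt_one.trans_le hp.out
  obtain ⟨g, hg, hgf⟩ := u.2.2
  exact ((iInf₂_le g (hg.isWeakUpperGradient hp0)).trans_lt
    (ENNReal.rpow_lt_top_of_nonneg (by positivity) hgf.ne)).ne

theorem norm_smul_le' (c : ℝ) (u : PreSobolev Ω V p ν) : ‖c • u‖ ≤ ‖c‖ * ‖u‖ := by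
  have hp0 : 0 < p := zero_lt_one.trans_le hp.out
  have h1 : (c • u).toFun = c • u.toFun := rfl
  have h2 := ENNReal.toReal_mono (ENNReal.mul_ne_top ENNReal.coe_ne_top u.dirichletSeminorm_ne_top)
    (dirichletSeminorm_smul_le hp0 (ν := ν) (Ω := Ω) c u.toFun)
  rw [ENNReal.toReal_mul, ENNReal.coe_toReal, coe_nnnorm] at h2
  rw [norm_def, norm_def, h1, eLpNorm_const_smul, ENNReal.toReal_mul, toReal_enorm, mul_add]
  gcongr

theorem seminormCore : SeminormedSpace.Core ℝ (PreSobolev Ω V p ν) where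
  norm_nonneg u := add_nonneg ENNReal.toReal_nonneg ENNReal.toReal_nonneg
  norm_smul c u := by
    refine le_antisymm (norm_smul_le' c u) ?_
    rcases eq_or_ne c 0 with rfl | hc
    · rw [norm_zero, zero_mul]
      exact add_nonneg ENNReal.toReal_nonneg ENNReal.toReal_nonneg
    · have h := norm_smul_le' c⁻¹ (c • u)
      rw [inv_smul_smul₀ hc, norm_inv] at h
      have hc' : 0 < ‖c‖ := norm_pos_iff.2 hc
      calc ‖c‖ * ‖u‖ ≤ ‖c‖ * (‖c‖⁻¹ * ‖c • u‖) := by gcongr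
        _ = ‖c • u‖ := by rw [mul_inv_cancel_left₀ hc'.ne']
  norm_triangle u v := by
    have h1 : (u + v).toFun = u.toFun + v.toFun := rfl
    have hp1 : (1 : ℝ≥0∞) ≤ ENNReal.ofReal p := by simpa using hp.out
    have hu : MemLp u.toFun (ENNReal.ofReal p) (ν.restrict Ω) := u.2.1
    have hv : MemLp v.toFun (ENNReal.ofReal p) (ν.restrict Ω) := v.2.1
    have e1 := ENNReal.toReal_mono (ENNReal.add_ne_top.2 ⟨hu.eLpNorm_ne_top, hv.eLpNorm_ne_top⟩)
      (eLpNorm_add_le hu.1 hv.1 hp1)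
    have e2 := ENNReal.toReal_mono
      (ENNReal.add_ne_top.2 ⟨u.dirichletSeminorm_ne_top, v.dirichletSeminorm_ne_top⟩)
      (dirichletSeminorm_add_le hp.out (ν := ν) (Ω := Ω) u.toFun v.toFun)
    rw [ENNReal.toReal_add hu.eLpNorm_ne_top hv.eLpNorm_ne_top] at e1
    rw [ENNReal.toReal_add u.dirichletSeminorm_ne_top v.dirichletSeminorm_ne_top] at e2
    rw [norm_def, norm_def, norm_def, h1]
    linarith

instance : SeminormedAddCommGroup (PreSobolev Ω V p ν) :=
  SeminormedAddCommGroup.ofCore seminormCore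

instance : NormedSpace ℝ (PreSobolev Ω V p ν) where
  norm_smul_le := norm_smul_le'

end PreSobolev

/-- The Sobolev space `N^{1,p}(Ω, V, ν)`: the quotient of `Ñ^{1,p}(Ω, V, ν)` by the functions of
seminorm zero, with the induced norm. -/
abbrev Sobolev (Ω : Set X) (V : Type*) [NormedAddCommGroup V] [NormedSpace ℝ V]
    (p : ℝ) [Fact (1 ≤ p)] (ν : Measure X) : Type _ :=
  SeparationQuotient (PreSobolev Ω V p ν)

end Sobolev

section Admissible

variable {X : Type*} [MetricSpace X] [MeasurableSpace X]

/-- `μ` is a doubling measure on `Ω`. -/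
def IsDoublingOn (μ : Measure X) (Ω : Set X) : Prop :=
  ∃ C : ℝ≥0, 1 ≤ C ∧ ∀ x ∈ closure Ω, ∀ r > 0,
    0 < μ (Metric.ball x (2 * r) ∩ Ω) ∧
    μ (Metric.ball x (2 * r) ∩ Ω) ≤ C * μ (Metric.ball x r ∩ Ω) ∧
    μ (Metric.ball x r ∩ Ω) < ∞

/-- The measure `H` on `∂Ω` is upper codimension-`θ` regular:
`H(B(x, r) ∩ ∂Ω) ≤ C μ(B(x, r) ∩ Ω) / r ^ θ` for `x ∈ ∂Ω` and `0 < r < 2 diam Ω`. -/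
def IsUpperCodimRegular (μ : Measure X) (Ω : Set X) (H : Measure (frontier Ω)) (θ : ℝ) : Prop :=
  ∃ C : ℝ≥0, ∀ x : frontier Ω, ∀ r : ℝ, 0 < r → r < 2 * Metric.diam Ω →
    H (Metric.ball x r) ≤ C * (μ (Metric.ball (x : X) r ∩ Ω) / ENNReal.ofReal (r ^ θ))

/-- `Ω` supports a local `q`-Poincaré inequality. The inequality is only asked for balls on which
`u` is integrable, since otherwise the mean value of `u` is meaningless. -/
def SupportsLocalPoincare (μ : Measure X) (Ω : Set X) (q : ℝ) : Prop :=
  ∃ C : ℝ≥0, 0 < C ∧ ∃ l : ℝ, 1 ≤ l ∧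
    ∀ u : X → ℝ, LocallyIntegrableOn u Ω μ → ∀ g : X → ℝ≥0∞, IsUpperGradient Ω u g →
    ∀ x ∈ Ω, ∀ r > 0, IntegrableOn u (Metric.ball x r ∩ Ω) μ →
      ⨍⁻ y in Metric.ball x r ∩ Ω, ‖u y - ⨍ z in Metric.ball x r ∩ Ω, u z ∂μ‖ₑ ∂μ ≤
        C * ENNReal.ofReal r * (⨍⁻ y in Metric.ball x (l * r) ∩ Ω, g y ^ q ∂μ) ^ (1 / q)

/-- `Ω` is weakly `θ`-admissible (with the measure `μ` on `Ω` and the measure `H` on `∂Ω`). -/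
structure IsWeaklyAdmissible (μ : Measure X) (Ω : Set X) (H : Measure (frontier Ω)) (θ : ℝ) :
    Prop where
  doubling : IsDoublingOn μ Ω
  upperCodim : IsUpperCodimRegular μ Ω H θ
  poincare : SupportsLocalPoincare μ Ω θ

/-- The weighted measure `ρ μ`, where `ρ(x) = ω(dist(x, ∂Ω))`. -/
def boundaryWeighted (μ : Measure X) (Ω : Set X) (ω : ℝ → ℝ) : Measure X :=
  μ.withDensity fun x => ENNReal.ofReal (ω (Metric.infDist x (frontier Ω)))

/-- `v` is the trace of `u : Ω → V` at the boundary point `x`: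
the mean value of `|u - v|` over `B(x, r) ∩ Ω` tends to `0` as `r → 0+`. -/
def HasTraceAt {V : Type*} [NormedAddCommGroup V] (μ : Measure X) (Ω : Set X) (u : X → V)
    (x : X) (v : V) : Prop :=
  Tendsto (fun r : ℝ => ⨍⁻ y in Metric.ball x r ∩ Ω, ‖u y - v‖ₑ ∂μ) (𝓝[>] 0) (𝓝 0)

end Admissible

instance fact_one_le_of_one_lt {p : ℝ} [h : Fact (1 < p)] : Fact (1 ≤ p) := ⟨h.out.le⟩

instance fact_one_le_ofReal {p : ℝ} [h : Fact (1 < p)] : Fact (1 ≤ ENNReal.ofReal p) :=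
  ⟨by simpa using h.out.le⟩

end

/-! Fix a boundary point `z` and compare the means of `u` over the dyadic balls `B(z, r₀ / 2 ^ k)`.
By doubling and the Poincaré inequality, consecutive means differ by at most a constant times `t (⨍
g ^ θ) ^ (1 / θ)` over `B(z, t) ∩ Ω`, with `t = t₀ / 2 ^ k`. Every point of that set is closer than
`t` to `∂Ω`, so its weight is at least `ω t`; inserting the weight under the average gains the
factor `ω t ^ (-1 / θ)`. The Dini condition says precisely that these factors are summable over
dyadic scales (`tsum_dyadic_ne_top`).

The differences are thus dominated by a potential `S z = ∑ φ_k (t_k ^ θ ⨍ ρ g ^ θ) ^ (1 / θ)` with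
summable `φ_k`. Jensen's inequality for the weights `φ_k` takes the `θ`-th power inside the sum, and
Fubini with codimension regularity bounds `∫ t ^ θ ⨍_{B(z,t)} ρ g ^ θ dH` by a multiple of `∫ ρ g ^
θ dμ`, uniformly in `t`. Hence `S` lies in `L^θ(H)` and is finite almost everywhere
(`lintegral_boundaryPotential_rpow_le`). Where it is finite the means converge, the oscillations
tend to zero, and the limit is the trace; its norm is controlled by `S` and by the mean at the
coarsest scale (`exists_trace`).

Two gaps remain. The Poincaré inequality is assumed only for real functions and centres in `Ω`,
while a Banach valued version with centres on `∂Ω` is needed. It is applied to `‖u - v‖`, which has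
the same upper gradients as `u`; telescoping at Lebesgue points bounds `‖u z - u y‖` by `I z + I y`
with `I` independent of `v`, and averaging over both variables gives the claim
(`exists_banach_poincare`). Moreover, the norm involves weak upper gradients, which are replaced by
genuine ones of almost the same norm (`exists_isUpperGradient_le_dirichletSeminorm_add`).

All metric arguments take place on `closure Ω` with the measure `μ` restricted to `Ω`, where the
hypothesis becomes doubling in the usual sense. Uniqueness of traces makes the result independent of
the upper gradient and linear in `u`. -/

theorem ENNReal.inv_le_mul_inv_of_le_mul {a b K : ℝ≥0∞} (h : b ≤ K * a) (ha : a ≠ 0) (ha' : a ≠ ∞)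
    (hb : b ≠ 0) (hb' : b ≠ ∞) : a⁻¹ ≤ K * b⁻¹ := by
  calc a⁻¹ = a⁻¹ * (b * b⁻¹) := by rw [ENNReal.mul_inv_cancel hb hb', mul_one]
    _ ≤ a⁻¹ * (K * a * b⁻¹) := by gcongr
    _ = K * b⁻¹ * (a * a⁻¹) := by ring
    _ = K * b⁻¹ := by rw [ENNReal.mul_inv_cancel ha ha', mul_one]

/-! ### Averages over sets and Jensen's inequality. -/

section MeasureLemmas

variable {Y : Type*} [MeasurableSpace Y] {m : Measure Y}

theorem setLAverage_le_mul_setLAverage {A B : Set Y} {K : ℝ≥0∞} (hAB : A ⊆ B)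
    (hK : m B ≤ K * m A) (hA : m A ≠ 0) (hB : m B ≠ ∞) (f : Y → ℝ≥0∞) :
    ⨍⁻ y in A, f y ∂m ≤ K * ⨍⁻ y in B, f y ∂m := by
  have hB0 : m B ≠ 0 := fun h => hA (measure_mono_null hAB h)
  have hAt : m A ≠ ∞ := ne_top_of_le_ne_top hB (measure_mono hAB)
  have hinv := ENNReal.inv_le_mul_inv_of_le_mul hK hA hAt hB0 hB
  rw [setLAverage_eq, setLAverage_eq, div_eq_mul_inv, div_eq_mul_inv]
  calc (∫⁻ y in A, f y ∂m) * (m A)⁻¹ ≤ (∫⁻ y in B, f y ∂m) * (K * (m B)⁻¹) :=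
        mul_le_mul' (lintegral_mono_set hAB) hinv
    _ = K * ((∫⁻ y in B, f y ∂m) * (m B)⁻¹) := by ring

theorem enorm_setAverage_sub_le {E : Type*} [NormedAddCommGroup E] [NormedSpace ℝ E]
    [CompleteSpace E] {A : Set Y} (hA : m A ≠ 0) (hAt : m A ≠ ∞) {w : Y → E}
    (hw : IntegrableOn w A m) (c : E) :
    ‖(⨍ y in A, w y ∂m) - c‖ₑ ≤ ⨍⁻ y in A, ‖w y - c‖ₑ ∂m := by
  have h : (⨍ y in A, w y ∂m) - c = ⨍ y in A, (w y - c) ∂m := by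
    conv_lhs => rw [← setAverage_const (μ := m) hA hAt c]
    rw [setAverage_eq, setAverage_eq, setAverage_eq,
      integral_sub hw (integrableOn_const hAt), smul_sub]
  rw [h, setLAverage_eq']
  rw [average_eq', Measure.restrict_apply_univ]
  exact enorm_integral_le_lintegral_enorm _

/-- Jensen's inequality for `t ↦ t ^ p` and a measure of arbitrary total mass. -/
theorem lintegral_rpow_le_mul_lintegral_rpow {p : ℝ} (hp : 1 < p) {f : Y → ℝ≥0∞}
    (hf : AEMeasurable f m) :
    (∫⁻ y, f y ∂m) ^ p ≤ m univ ^ (p - 1) * ∫⁻ y, f y ^ p ∂m := by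
  have hp0 : 0 < p := by linarith
  have hpq := Real.HolderConjugate.conjExponent hp
  have h := ENNReal.lintegral_mul_le_Lp_mul_Lq m hpq hf (aemeasurable_const (b := (1 : ℝ≥0∞)))
  simp only [Pi.mul_apply, mul_one, ENNReal.one_rpow, lintegral_const, one_mul] at h
  calc (∫⁻ y, f y ∂m) ^ p
      ≤ ((∫⁻ y, f y ^ p ∂m) ^ (1 / p) * m univ ^ (1 / Real.conjExponent p)) ^ p :=
        ENNReal.rpow_le_rpow h hp0.le
    _ = m univ ^ (p - 1) * ∫⁻ y, f y ^ p ∂m := by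
        rw [ENNReal.mul_rpow_of_nonneg _ _ hp0.le, ← ENNReal.rpow_mul, ← ENNReal.rpow_mul,
          one_div_mul_cancel hp0.ne', ENNReal.rpow_one, mul_comm]
        congr 2
        rw [Real.conjExponent]
        have : p - 1 ≠ 0 := by linarith
        field_simp

theorem setLAverage_rpow_le {p : ℝ} (hp : 1 < p) {A : Set Y} (hA : m A ≠ 0) (hAt : m A ≠ ∞)
    {f : Y → ℝ≥0∞} (hf : AEMeasurable f (m.restrict A)) :
    (⨍⁻ y in A, f y ∂m) ^ p ≤ ⨍⁻ y in A, f y ^ p ∂m := by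
  rw [setLAverage_eq', setLAverage_eq']
  have h := lintegral_rpow_le_mul_lintegral_rpow (m := (m A)⁻¹ • m.restrict A) hp
    (hf.smul_measure _)
  simpa [ENNReal.inv_mul_cancel hA hAt] using h

theorem setLAverage_rpow_inv_le {p : ℝ} (hp : 1 < p) {A : Set Y} (hA : m A ≠ 0) (hAt : m A ≠ ∞)
    {f : Y → ℝ≥0∞} (hf : AEMeasurable f (m.restrict A)) :
    ⨍⁻ y in A, f y ^ (1 / p) ∂m ≤ (⨍⁻ y in A, f y ∂m) ^ (1 / p) := by
  have hp0 : 0 < p := by linarith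
  rw [one_div, ENNReal.le_rpow_inv_iff hp0]
  refine (setLAverage_rpow_le hp hA hAt (hf.pow_const _)).trans_eq ?_
  simp_rw [← ENNReal.rpow_mul, inv_mul_cancel₀ hp0.ne', ENNReal.rpow_one]

/-- Jensen's inequality for counting measure with density `w`, whose total mass is `∑' k, w k`. -/
theorem tsum_mul_rpow_le {p : ℝ} (hp : 1 < p) (w b : ℕ → ℝ≥0∞) :
    (∑' k, w k * b k) ^ p ≤ (∑' k, w k) ^ (p - 1) * ∑' k, w k * b k ^ p := by
  have h := lintegral_rpow_le_mul_lintegral_rpow (m := Measure.count.withDensity w) hp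
    (f := b) (measurable_of_countable _).aemeasurable
  rw [lintegral_withDensity_eq_lintegral_mul _ (measurable_of_countable _)
      (measurable_of_countable _), lintegral_withDensity_eq_lintegral_mul _
      (measurable_of_countable _) (measurable_of_countable _), lintegral_count, lintegral_count,
      withDensity_apply _ MeasurableSet.univ, Measure.restrict_univ, lintegral_count] at h
  simpa using h

theorem setLAverage_const_mul {A : Set Y} {c : ℝ≥0∞} {f : Y → ℝ≥0∞}
    (hf : Measurable f) : ⨍⁻ y in A, c * f y ∂m = c * ⨍⁻ y in A, f y ∂m := by
  rw [setLAverage_eq, setLAverage_eq, lintegral_const_mul _ hf, mul_div_assoc]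

theorem setLAverage_le_add {A : Set Y} (hA : m A ≠ 0) (hAt : m A ≠ ∞) {f g : Y → ℝ≥0∞} {c : ℝ≥0∞}
    (h : ∀ᵐ y ∂m, y ∈ A → f y ≤ g y + c) (hAm : MeasurableSet A) :
    ⨍⁻ y in A, f y ∂m ≤ (⨍⁻ y in A, g y ∂m) + c := by
  have h1 : ∫⁻ y in A, f y ∂m ≤ (∫⁻ y in A, g y ∂m) + c * m A := by
    refine (lintegral_mono_ae ((ae_restrict_iff' hAm).2 h)).trans_eq ?_
    rw [lintegral_add_right _ measurable_const, setLIntegral_const]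
  rw [setLAverage_eq, setLAverage_eq]
  refine (ENNReal.div_le_div_right h1 _).trans_eq ?_
  rw [ENNReal.add_div, ENNReal.mul_div_cancel_right hA hAt]

/-- Means over two nested comparable sets differ at most by a multiple of the mean oscillation. -/
theorem edist_average_average_le {E : Type*} [NormedAddCommGroup E] [NormedSpace ℝ E]
    [CompleteSpace E] {w : Y → E} (hw : Integrable w m) {A B : Set Y} {K : ℝ≥0∞} (hAB : A ⊆ B)
    (hK : m B ≤ K * m A) (hA : m A ≠ 0) (hB : m B ≠ ∞) :
    edist (⨍ z in B, w z ∂m) (⨍ z in A, w z ∂m) ≤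
      K * ⨍⁻ y in B, ‖w y - ⨍ z in B, w z ∂m‖ₑ ∂m := by
  rw [edist_comm, edist_eq_enorm_sub]
  exact (enorm_setAverage_sub_le hA (ne_top_of_le_ne_top hB (measure_mono hAB))
    hw.integrableOn _).trans (setLAverage_le_mul_setLAverage hAB hK hA hB _)

end MeasureLemmas

/-! ### Doubling spaces: separability, Lebesgue differentiation, telescoping of dyadic means. -/

/-- `m` is positive and finite on balls, and `m (B(x, 2r)) ≤ C m (B(x, r))` for all balls. -/
structure IsDoublingWith {Y : Type*} [PseudoMetricSpace Y] [MeasurableSpace Y] (m : Measure Y)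
    (C : ℝ≥0) : Prop where
  pos : ∀ x, ∀ r > 0, m (Metric.ball x r) ≠ 0
  finite : ∀ x, ∀ r > 0, m (Metric.ball x r) ≠ ∞
  doubling : ∀ x, ∀ r > 0, m (Metric.ball x (2 * r)) ≤ C * m (Metric.ball x r)

/-- A maximal `ε`-separated set is `ε`-dense. The balls of radius `ε / 2` about its points are
disjoint and have positive measure, so an s-finite measure allows only countably many of them.
Second countability is what makes the distance jointly measurable in the Fubini arguments. -/
theorem secondCountableTopology_of_measure_ball_ne_zero {Y : Type*} [PseudoMetricSpace Y]
    [MeasurableSpace Y] [OpensMeasurableSpace Y] (m : Measure Y) [SFinite m]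
    (hm : ∀ x, ∀ r > 0, m (Metric.ball x r) ≠ 0) : SecondCountableTopology Y := by
  refine Metric.secondCountable_of_almost_dense_set fun ε hε => ?_
  obtain ⟨N, hN⟩ := zorn_subset {N : Set Y | N.Pairwise fun x y => ε < dist x y} (by
    intro c hc hchain
    refine ⟨⋃₀ c, ?_, fun s hs => subset_sUnion_of_mem hs⟩
    exact (pairwise_sUnion hchain.directedOn).2 fun s hs => hc hs)
  have hNp : N.Pairwise fun x y => ε < dist x y := hN.1
  refine ⟨N, ?_, fun x => ?_⟩
  · have hdisj : Pairwise (Function.onFun Disjoint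
        fun x : N => Metric.ball (x : Y) (ε / 2)) := by
      intro x y hxy
      refine Metric.ball_disjoint_ball ?_
      have := hNp x.2 y.2 (fun h => hxy (Subtype.ext h))
      linarith
    have hc := Measure.countable_meas_pos_of_disjoint_iUnion (μ := m)
      (fun x : N => Metric.isOpen_ball.measurableSet) hdisj
    have hu : {i : N | 0 < m (Metric.ball (i : Y) (ε / 2))} = univ :=
      eq_univ_of_forall fun i => pos_iff_ne_zero.2 (hm i _ (by positivity))
    rw [hu] at hc
    exact countable_coe_iff.1 (countable_univ_iff.1 hc)
  · by_contra! hx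
    have hxN : x ∉ N := fun h => by
      have := hx x h
      rw [dist_self] at this
      linarith
    have hins : insert x N ∈ {N : Set Y | N.Pairwise fun x y => ε < dist x y} :=
      hNp.insert fun y hy _ => ⟨hx y hy, by rw [dist_comm]; exact hx y hy⟩
    exact hxN (hN.2 hins (subset_insert x N) (mem_insert x N))

namespace IsDoublingWith

variable {Y : Type*} [PseudoMetricSpace Y] [MeasurableSpace Y] {m : Measure Y} {C : ℝ≥0}

theorem measure_ball_pow_le (hm : IsDoublingWith m C) (x : Y) {r : ℝ} (hr : 0 < r) (n : ℕ) :
    m (Metric.ball x (2 ^ n * r)) ≤ C ^ n * m (Metric.ball x r) := by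
  induction n with
  | zero => simp
  | succ n ih =>
    have h := hm.doubling x (2 ^ n * r) (by positivity)
    calc m (Metric.ball x (2 ^ (n + 1) * r)) = m (Metric.ball x (2 * (2 ^ n * r))) := by
          congr 2; ring
      _ ≤ C * (C ^ n * m (Metric.ball x r)) := h.trans (by gcongr)
      _ = C ^ (n + 1) * m (Metric.ball x r) := by ring

theorem measure_ball_le_of_le (hm : IsDoublingWith m C) {x y : Y} {r s : ℝ} (hr : 0 < r) {n : ℕ}
    (h : s + dist y x ≤ 2 ^ n * r) : m (Metric.ball y s) ≤ C ^ n * m (Metric.ball x r) :=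
  (measure_mono (Metric.ball_subset_ball' h)).trans (hm.measure_ball_pow_le x hr n)

theorem isUnifLocDoublingMeasure (hm : IsDoublingWith m C) : IsUnifLocDoublingMeasure m := by
  -- Closed balls cost one extra doubling: the closed ball of radius `2 * ε` lies in the open ball
  -- of radius `4 * ε`.
  refine ⟨C ^ 2, ?_⟩
  filter_upwards [self_mem_nhdsWithin] with ε hε x
  have hε : 0 < ε := hε
  calc m (Metric.closedBall x (2 * ε)) ≤ m (Metric.ball x (2 ^ 2 * ε)) :=
        measure_mono (Metric.closedBall_subset_ball (by linarith))
    _ ≤ C ^ 2 * m (Metric.ball x ε) := hm.measure_ball_pow_le x hε 2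
    _ ≤ _ := by
      push_cast
      gcongr
      exact Metric.ball_subset_closedBall

theorem isLocallyFiniteMeasure (hm : IsDoublingWith m C) : IsLocallyFiniteMeasure m :=
  ⟨fun x => ⟨Metric.ball x 1, Metric.ball_mem_nhds x one_pos,
    (hm.finite x 1 one_pos).lt_top⟩⟩

/-- Lebesgue's differentiation theorem along open balls. -/
theorem ae_tendsto_setLAverage [BorelSpace Y] [SecondCountableTopology Y]
    (hm : IsDoublingWith m C) {E : Type*} [NormedAddCommGroup E] {u : Y → E}
    (hu : Integrable u m) :
    ∀ᵐ y ∂m, ∀ δ : ℕ → ℝ, Tendsto δ atTop (𝓝[>] 0) →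
      Tendsto (fun k => ⨍⁻ z in Metric.ball y (δ k), ‖u z - u y‖ₑ ∂m) atTop (𝓝 0) := by
  have := hm.isUnifLocDoublingMeasure
  have := hm.isLocallyFiniteMeasure
  filter_upwards [IsUnifLocDoublingMeasure.ae_tendsto_average_norm_sub m hu.locallyIntegrable 1]
    with y hy δ hδ
  have hpos : ∀ᶠ k in atTop, 0 < δ k := hδ self_mem_nhdsWithin
  have h1 := hy (fun _ => y) δ hδ (hpos.mono fun k hk => Metric.mem_closedBall_self (by linarith))
  have h2 := ENNReal.Tendsto.const_mul (a := (C : ℝ≥0∞)) (ENNReal.tendsto_ofReal h1)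
    (Or.inr ENNReal.coe_ne_top)
  rw [ENNReal.ofReal_zero, mul_zero] at h2
  refine tendsto_of_tendsto_of_tendsto_of_le_of_le' tendsto_const_nhds h2
    (Eventually.of_forall fun _ => zero_le) (hpos.mono fun k hk => ?_)
  have hfin : m (Metric.closedBall y (δ k)) ≠ ∞ :=
    ne_top_of_le_ne_top (hm.finite y (2 * δ k) (by positivity))
      (measure_mono (Metric.closedBall_subset_ball (by linarith)))
  have hle := setLAverage_le_mul_setLAverage (m := m) (K := C) (A := Metric.ball y (δ k))
    (B := Metric.closedBall y (δ k)) Metric.ball_subset_closedBall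
    ((measure_mono (Metric.closedBall_subset_ball (by linarith))).trans (hm.doubling y _ hk))
    (hm.pos y _ hk) hfin (fun z => ‖u z - u y‖ₑ)
  refine hle.trans_eq ?_
  congr 1
  rw [ofReal_setAverage, setLAverage_eq]
  · simp
  · exact (hu.integrableOn.sub (integrableOn_const hfin)).norm
  · exact Eventually.of_forall fun _ => norm_nonneg _

theorem tendsto_div_two_pow {r : ℝ} (hr : 0 < r) :
    Tendsto (fun k : ℕ => r / 2 ^ k) atTop (𝓝[>] 0) := by
  refine tendsto_nhdsWithin_iff.2 ⟨?_, Eventually.of_forall fun k => by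
    simp only [mem_Ioi]; positivity⟩
  have h := (tendsto_pow_atTop_nhds_zero_of_lt_one (r := (1 / 2 : ℝ)) (by norm_num)
    (by norm_num)).const_mul r
  simp_rw [mul_zero] at h
  refine h.congr fun k => ?_
  rw [one_div, inv_pow, div_eq_mul_inv]

theorem edist_average_ball_succ_le (hm : IsDoublingWith m C) {E : Type*} [NormedAddCommGroup E]
    [NormedSpace ℝ E] [CompleteSpace E] {w : Y → E} (hw : Integrable w m) (x : Y) {r : ℝ}
    (hr : 0 < r) (k : ℕ) :
    edist (⨍ z in Metric.ball x (r / 2 ^ k), w z ∂m)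
        (⨍ z in Metric.ball x (r / 2 ^ (k + 1)), w z ∂m) ≤
      C * ⨍⁻ y in Metric.ball x (r / 2 ^ k),
        ‖w y - ⨍ z in Metric.ball x (r / 2 ^ k), w z ∂m‖ₑ ∂m := by
  have h : r / 2 ^ k = 2 * (r / 2 ^ (k + 1)) := by rw [pow_succ]; field_simp
  refine edist_average_average_le hw (Metric.ball_subset_ball ?_) ?_
    (hm.pos _ _ (by positivity)) (hm.finite _ _ (by positivity))
  · have : 0 < r / 2 ^ (k + 1) := by positivity
    linarith
  · nth_rewrite 1 [h]
    exact hm.doubling x _ (by positivity)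

end IsDoublingWith

/-! ### Measurability of ball averages in the centre, and Fubini's theorem for them. -/

section BallAverages

variable {Y : Type*} [PseudoMetricSpace Y] [MeasurableSpace Y] [BorelSpace Y]
  [SecondCountableTopology Y] {m : Measure Y} {Z : Type*} [MeasurableSpace Z]

theorem measurableSet_dist_lt {ι : Z → Y} (hι : Measurable ι) (r : ℝ) :
    MeasurableSet {q : Z × Y | dist q.2 (ι q.1) < r} :=
  measurableSet_lt (measurable_snd.dist (hι.comp measurable_fst)) measurable_const

theorem measurable_measure_ball [SFinite m] {ι : Z → Y} (hι : Measurable ι) (r : ℝ) :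
    Measurable fun z => m (Metric.ball (ι z) r) :=
  measurable_measure_prodMk_left (measurableSet_dist_lt hι r)

theorem measurable_setLAverage_ball [SFinite m] {ι : Z → Y} (hι : Measurable ι) (r : ℝ)
    {G : Y → ℝ≥0∞} (hG : Measurable G) :
    Measurable fun z => ⨍⁻ y in Metric.ball (ι z) r, G y ∂m := by
  simp_rw [setLAverage_eq]
  refine Measurable.div ?_ (measurable_measure_ball hι r)
  have h : Measurable fun z => ∫⁻ y,
      {q : Z × Y | dist q.2 (ι q.1) < r}.indicator (fun q => G q.2) (z, y) ∂m :=
    Measurable.lintegral_prod_right'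
      ((hG.comp measurable_snd).indicator (measurableSet_dist_lt hι r))
  convert! h using 2 with z
  rw [← lintegral_indicator Metric.isOpen_ball.measurableSet]
  rfl

theorem stronglyMeasurable_setAverage_ball [SFinite m] {E : Type*} [NormedAddCommGroup E]
    [NormedSpace ℝ E] {ι : Z → Y} (hι : Measurable ι) (r : ℝ) {u : Y → E}
    (hu : AEStronglyMeasurable u m) :
    StronglyMeasurable fun z => ⨍ y in Metric.ball (ι z) r, u y ∂m := by
  simp_rw [setAverage_eq]
  refine StronglyMeasurable.smul
    (measurable_measure_ball hι r).ennreal_toReal.inv.stronglyMeasurable ?_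
  -- Averages do not see null sets, so `u` may be replaced by a strongly measurable representative,
  -- which makes the integrand jointly measurable.
  have h : StronglyMeasurable fun z => ∫ y,
      {q : Z × Y | dist q.2 (ι q.1) < r}.indicator (fun q => hu.mk u q.2) (z, y) ∂m :=
    StronglyMeasurable.integral_prod_right'
      ((hu.stronglyMeasurable_mk.comp_measurable measurable_snd).indicator
        (measurableSet_dist_lt hι r))
  convert! h using 2 with z
  rw [integral_congr_ae (ae_restrict_of_ae hu.ae_eq_mk),
    ← integral_indicator Metric.isOpen_ball.measurableSet]
  rfl

/-- Integrating ball averages against a measure `ν` whose balls are controlled by `m`. -/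
theorem lintegral_setLAverage_ball_le [SFinite m] {ν : Measure Z} [IsFiniteMeasure ν]
    {ι : Z → Y} (hι : Measurable ι) {r : ℝ} {K : ℝ≥0∞}
    (hpos : ∀ z, m (Metric.ball (ι z) r) ≠ 0) (hfin : ∀ z, m (Metric.ball (ι z) r) ≠ ∞)
    (hK : ∀ y z, dist (ι z) y < r → ν (ι ⁻¹' Metric.ball y r) ≤ K * m (Metric.ball (ι z) r))
    {G : Y → ℝ≥0∞} (hG : Measurable G) :
    ∫⁻ z, ⨍⁻ y in Metric.ball (ι z) r, G y ∂m ∂ν ≤ K * ∫⁻ y, G y ∂m := by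
  set S : Set (Z × Y) := {q : Z × Y | dist q.2 (ι q.1) < r} with hS
  have hSm : MeasurableSet S := measurableSet_dist_lt hι r
  have hbm := measurable_measure_ball (m := m) hι r
  set F : Z → Y → ℝ≥0∞ := fun z y =>
    S.indicator (fun q => G q.2 * (m (Metric.ball (ι q.1) r))⁻¹) (z, y) with hF
  have hFm : Measurable (Function.uncurry F) :=
    ((hG.comp measurable_snd).mul (hbm.comp measurable_fst).inv).indicator hSm
  have h1 : ∀ z, ⨍⁻ y in Metric.ball (ι z) r, G y ∂m = ∫⁻ y, F z y ∂m := by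
    intro z
    rw [setLAverage_eq, div_eq_mul_inv, ← lintegral_mul_const _ hG,
      ← lintegral_indicator Metric.isOpen_ball.measurableSet]
    rfl
  -- For fixed `y` only the `z` in `A = ι ⁻¹' B(y, r)` contribute, and there the normalising factor
  -- is at most `K / ν A`, which integrates to at most `K`.
  have h2 : ∀ y, ∫⁻ z, F z y ∂ν ≤ K * G y := by
    intro y
    set A : Set Z := ι ⁻¹' Metric.ball y r with hA
    have hAm : MeasurableSet A := hι Metric.isOpen_ball.measurableSet
    have h3 : ∫⁻ z, F z y ∂ν = ∫⁻ z in A, G y * (m (Metric.ball (ι z) r))⁻¹ ∂ν := by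
      rw [← lintegral_indicator hAm]
      refine lintegral_congr fun z => ?_
      simp only [hF, hS, hA, indicator, mem_ofPred_eq, mem_preimage, Metric.mem_ball, dist_comm y]
    rw [h3]
    rcases eq_or_ne (ν A) 0 with h0 | h0
    · rw [Measure.restrict_eq_zero.2 h0]; simp
    · calc ∫⁻ z in A, G y * (m (Metric.ball (ι z) r))⁻¹ ∂ν
          ≤ ∫⁻ z in A, G y * (K * (ν A)⁻¹) ∂ν := by
            refine setLIntegral_mono measurable_const fun z hz => ?_
            gcongr
            exact ENNReal.inv_le_mul_inv_of_le_mul (hK y z hz) (hpos z) (hfin z) h0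
              (measure_ne_top _ _)
        _ = K * G y * ((ν A)⁻¹ * ν A) := by rw [setLIntegral_const]; ring
        _ = K * G y := by rw [ENNReal.inv_mul_cancel h0 (measure_ne_top _ _), mul_one]
  calc ∫⁻ z, ⨍⁻ y in Metric.ball (ι z) r, G y ∂m ∂ν = ∫⁻ z, ∫⁻ y, F z y ∂m ∂ν :=
        lintegral_congr h1
    _ = ∫⁻ y, ∫⁻ z, F z y ∂ν ∂m := lintegral_lintegral_swap hFm.aemeasurable
    _ ≤ ∫⁻ y, K * G y ∂m := lintegral_mono h2
    _ = K * ∫⁻ y, G y ∂m := lintegral_const_mul _ hG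

end BallAverages

/-! ### From the real valued to the Banach valued Poincaré inequality. -/

namespace IsDoublingWith

variable {Y : Type*} [PseudoMetricSpace Y] [MeasurableSpace Y]
  {m : Measure Y} {C : ℝ≥0} {V : Type*} [NormedAddCommGroup V]

/-- The Poincaré inequality, with the measurable function `G` in the role of `g ^ p`, for the
functions `‖u - v‖` and balls centred at `y`. -/
def NormPoincareAt (m : Measure Y) (u : Y → V) (G : Y → ℝ≥0∞) (p : ℝ) (D : ℝ≥0) (l : ℝ)
    (y : Y) : Prop :=
  ∀ v : V, ∀ r > 0,
    ⨍⁻ z in Metric.ball y r, ‖‖u z - v‖ - ⨍ t in Metric.ball y r, ‖u t - v‖ ∂m‖ₑ ∂m ≤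
      D * (ENNReal.ofReal r * (⨍⁻ z in Metric.ball y (l * r), G z ∂m) ^ (1 / p))

/-- Telescoping over the balls `B(y, 2r / 2 ^ k)`, which shrink to the Lebesgue point `y`, then one
comparison of `B(y, 2r)` with `B(x, r)`. The Lebesgue point condition concerns `u`, not `‖u - v‖`,
so the exceptional null set does not depend on `v`; neither does the right hand side. This permits
taking for `v` a value of `u`. -/
theorem edist_norm_sub_average_le (hm : IsDoublingWith m C) [IsFiniteMeasure m] {u : Y → V}
    (hu : Integrable u m) {G : Y → ℝ≥0∞} {p : ℝ} {D : ℝ≥0} {l : ℝ} {y : Y}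
    (hP : NormPoincareAt m u G p D l y)
    (hL : ∀ δ : ℕ → ℝ, Tendsto δ atTop (𝓝[>] 0) →
      Tendsto (fun k => ⨍⁻ z in Metric.ball y (δ k), ‖u z - u y‖ₑ ∂m) atTop (𝓝 0))
    {x : Y} {r : ℝ} (hr : 0 < r) (hy : y ∈ Metric.ball x r) (v : V) :
    edist ‖u y - v‖ (⨍ t in Metric.ball x r, ‖u t - v‖ ∂m) ≤
      (C + C ^ 2) * D * ∑' k : ℕ, ENNReal.ofReal (2 * r / 2 ^ k) *
        (⨍⁻ z in Metric.ball y (l * (2 * r / 2 ^ k)), G z ∂m) ^ (1 / p) := by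
  set w : Y → ℝ := fun z => ‖u z - v‖ with hw
  have hwi : Integrable w m := (hu.sub (integrable_const v)).norm
  set J : ℕ → ℝ≥0∞ := fun k => ENNReal.ofReal (2 * r / 2 ^ k) *
        (⨍⁻ z in Metric.ball y (l * (2 * r / 2 ^ k)), G z ∂m) ^ (1 / p) with hJ
  have h2r : 0 < 2 * r := by positivity
  have hJ' : ∀ k, ⨍⁻ z in Metric.ball y (2 * r / 2 ^ k),
      ‖w z - ⨍ t in Metric.ball y (2 * r / 2 ^ k), w t ∂m‖ₑ ∂m ≤ D * J k :=
    fun k => hP v _ (by positivity)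
  have hlim : Tendsto (fun k : ℕ => ⨍ z in Metric.ball y (2 * r / 2 ^ k), w z ∂m) atTop
      (𝓝 (w y)) := by
    rw [tendsto_iff_edist_tendsto_0]
    refine tendsto_of_tendsto_of_tendsto_of_le_of_le tendsto_const_nhds
      (hL _ (tendsto_div_two_pow h2r)) (fun _ => zero_le) fun k => ?_
    rw [edist_eq_enorm_sub]
    refine (enorm_setAverage_sub_le (hm.pos _ _ (by positivity)) (measure_ne_top _ _)
      hwi.integrableOn _).trans ?_
    rw [setLAverage_eq, setLAverage_eq]
    gcongr with z
    rw [enorm_le_iff_norm_le, Real.norm_eq_abs]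
    have := abs_norm_sub_norm_le (u z - v) (u y - v)
    rwa [sub_sub_sub_cancel_right] at this
  have h1 := edist_le_tsum_of_edist_le_of_tendsto₀ (fun k => C * (D * J k))
    (fun k => (hm.edist_average_ball_succ_le hwi y h2r k).trans
      (mul_le_mul_right (hJ' k) _)) hlim
  rw [pow_zero, div_one] at h1
  have hd : dist y x < r := hy
  -- `B(x, r) ⊆ B(y, 2r) ⊆ B(x, 4r)`, whence two doublings. The cost is the `k = 0` term of the sum
  -- once more.
  have h2 : edist (⨍ z in Metric.ball y (2 * r), w z ∂m) (⨍ z in Metric.ball x r, w z ∂m) ≤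
      C ^ 2 * (D * J 0) := by
    refine (edist_average_average_le hwi (K := C ^ 2) (Metric.ball_subset_ball' ?_) ?_
      (hm.pos _ _ hr) (measure_ne_top _ _)).trans ?_
    · rw [dist_comm]; linarith
    · exact hm.measure_ball_le_of_le hr (by linarith)
    · have := hJ' 0
      rw [pow_zero, div_one] at this
      gcongr
  calc edist (w y) (⨍ t in Metric.ball x r, w t ∂m)
      ≤ edist (w y) (⨍ z in Metric.ball y (2 * r), w z ∂m) +
        edist (⨍ z in Metric.ball y (2 * r), w z ∂m) (⨍ z in Metric.ball x r, w z ∂m) :=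
        edist_triangle _ _ _
    _ ≤ ∑' k, C * (D * J k) + C ^ 2 * (D * J 0) := by
        rw [edist_comm (w y)]
        exact add_le_add h1 h2
    _ ≤ C * D * ∑' k, J k + C ^ 2 * (D * ∑' k, J k) := by
        gcongr
        · simp_rw [← mul_assoc]
          rw [ENNReal.tsum_mul_left]
        · exact ENNReal.le_tsum 0
    _ = _ := by ring

theorem tsum_ofReal_div_two_pow {r : ℝ} (hr : 0 ≤ r) :
    ∑' k : ℕ, ENNReal.ofReal (r / 2 ^ k) = ENNReal.ofReal (2 * r) := by
  have h : HasSum (fun k : ℕ => r / 2 ^ k) (2 * r) := by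
    have := hasSum_geometric_two.mul_left r
    rw [mul_comm r] at this
    refine this.congr_fun ?_
    intro k
    rw [one_div, inv_pow, div_eq_mul_inv]
  rw [← ENNReal.ofReal_tsum_of_nonneg (fun k => by positivity) h.summable, h.tsum_eq]

/-- Fubini with the measure `m` restricted to `B(x, r)`: swapping the integrals costs one factor
`C`, since `B(y, s) ⊆ B(z, 2s)` when `z` is within `s` of `y`. Only values of `G` in `B(x, r + s)`
matter, and passing to the average over the larger ball costs `C ^ N`. -/
theorem setLAverage_setLAverage_ball_le (hm : IsDoublingWith m C) [IsFiniteMeasure m]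
    [BorelSpace Y] [SecondCountableTopology Y] {G : Y → ℝ≥0∞} (hG : Measurable G) {x : Y} {r s : ℝ} (hr : 0 < r)
    (hs : 0 < s) {N : ℕ} (hN : r + s ≤ 2 ^ N * r) :
    ⨍⁻ y in Metric.ball x r, ⨍⁻ z in Metric.ball y s, G z ∂m ∂m ≤
      C ^ (N + 1) * ⨍⁻ z in Metric.ball x (2 ^ N * r), G z ∂m := by
  set B := Metric.ball x (2 ^ N * r) with hB
  have h1 : ∫⁻ y in Metric.ball x r, ⨍⁻ z in Metric.ball y s, G z ∂m ∂m ≤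
      C * ∫⁻ z in B, G z ∂m := by
    have h2 := lintegral_setLAverage_ball_le (m := m) (ν := m.restrict (Metric.ball x r))
      (ι := fun y => y) measurable_id (r := s) (K := C)
      (fun z => hm.pos z s hs) (fun z => measure_ne_top _ _)
      (fun y z hyz => (Measure.restrict_apply_le _ _).trans (by
        have := hm.measure_ball_le_of_le (x := z) (y := y) (s := s) hs (n := 1) (by
          rw [dist_comm]; linarith)
        simpa using this)) (hG.indicator (Metric.isOpen_ball (x := x) (ε := 2 ^ N * r)).measurableSet)
    rw [lintegral_indicator Metric.isOpen_ball.measurableSet] at h2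
    refine le_trans (setLIntegral_mono' Metric.isOpen_ball.measurableSet fun y hy => ?_) h2
    refine (setLAverage_congr_fun Metric.isOpen_ball.measurableSet fun z hz => ?_).le
    refine (indicator_of_mem (Metric.ball_subset_ball' ?_ hz) _).symm
    have : dist y x < r := hy
    linarith
  have h3 := hm.measure_ball_pow_le x hr N
  have h4 := ENNReal.inv_le_mul_inv_of_le_mul h3 (hm.pos x r hr) (measure_ne_top _ _)
    (hm.pos x _ (by positivity)) (measure_ne_top _ _)
  rw [setLAverage_eq, setLAverage_eq, div_eq_mul_inv, div_eq_mul_inv]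
  calc _ ≤ (C * ∫⁻ z in B, G z ∂m) * (C ^ N * (m B)⁻¹) := by gcongr
    _ = _ := by ring

/-- The Poincaré inequality for Banach space valued functions on all balls, from the real valued one
for the functions `‖u - v‖` on balls with almost every centre. -/
theorem exists_banach_poincare (hm : IsDoublingWith m C) [IsFiniteMeasure m]
    [BorelSpace Y] [SecondCountableTopology Y] [NormedSpace ℝ V] [CompleteSpace V] {p : ℝ} (hp : 1 < p) (D : ℝ≥0)
    {l : ℝ} (hl : 0 < l) :
    ∃ K : ℝ≥0, ∃ N : ℕ, ∀ (u : Y → V) (G : Y → ℝ≥0∞), Integrable u m → Measurable G →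
      (∀ᵐ y ∂m, NormPoincareAt m u G p D l y) → ∀ x : Y, ∀ r > 0,
      ⨍⁻ y in Metric.ball x r, ‖u y - ⨍ z in Metric.ball x r, u z ∂m‖ₑ ∂m ≤
        K * ENNReal.ofReal r * (⨍⁻ y in Metric.ball x (2 ^ N * r), G y ∂m) ^ (1 / p) := by
  have hp0 : 0 < 1 / p := by positivity
  -- For `y ∈ B(x, r)` the largest ball occurring in `I y` is `B(y, 2lr)`, contained in `B(x, (1 +
  -- 2l)r)`.
  obtain ⟨N, hN⟩ := pow_unbounded_of_one_lt (1 + 2 * l) one_lt_two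
  refine ⟨2 * ((C + C ^ 2) * D) * 4 * (C ^ (N + 1)) ^ (1 / p), N, fun u G hu hG hP x r hr => ?_⟩
  set B := Metric.ball x r with hB
  have hBm : MeasurableSet B := Metric.isOpen_ball.measurableSet
  have hB0 : m B ≠ 0 := hm.pos x r hr
  have hBt : m B ≠ ∞ := measure_ne_top _ _
  set A := ⨍⁻ y in Metric.ball x (2 ^ N * r), G y ∂m with hA
  set J : ℕ → Y → ℝ≥0∞ := fun k y => (⨍⁻ z in Metric.ball y (l * (2 * r / 2 ^ k)), G z ∂m) ^ (1 / p)
    with hJ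
  have hJm : ∀ k, Measurable (J k) := fun k =>
    (measurable_setLAverage_ball measurable_id _ hG).pow_const _
  set I : Y → ℝ≥0∞ := fun y => (C + C ^ 2) * D * ∑' k : ℕ, ENNReal.ofReal (2 * r / 2 ^ k) * J k y
    with hI
  have hIB : ⨍⁻ y in B, I y ∂m ≤
      (C + C ^ 2) * D * (ENNReal.ofReal (4 * r) * (C ^ (N + 1) * A) ^ (1 / p)) := by
    have hJB : ∀ k, ⨍⁻ y in B, J k y ∂m ≤ (C ^ (N + 1) * A) ^ (1 / p) := by
      intro k
      refine (setLAverage_rpow_inv_le hp hB0 hBt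
        (measurable_setLAverage_ball measurable_id _ hG).aemeasurable).trans ?_
      refine ENNReal.rpow_le_rpow (hm.setLAverage_setLAverage_ball_le hG hr (by positivity) ?_)
        hp0.le
      have h2 : 2 * r / 2 ^ k ≤ 2 * r :=
        div_le_self (by positivity) (one_le_pow₀ (by norm_num))
      nlinarith
    have hs : ⨍⁻ y in B, ∑' k : ℕ, ENNReal.ofReal (2 * r / 2 ^ k) * J k y ∂m =
        ∑' k : ℕ, ENNReal.ofReal (2 * r / 2 ^ k) * ⨍⁻ y in B, J k y ∂m := by
      simp_rw [← setLAverage_const_mul (hJm _), setLAverage_eq, div_eq_mul_inv]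
      rw [lintegral_tsum fun k => ((hJm k).const_mul _).aemeasurable, ENNReal.tsum_mul_right]
    rw [hI, setLAverage_const_mul (Measurable.tsum fun k => (hJm k).const_mul _), hs]
    gcongr
    refine (ENNReal.tsum_le_tsum fun k => mul_le_mul_right (hJB k) _).trans_eq ?_
    rw [ENNReal.tsum_mul_right, tsum_ofReal_div_two_pow (by positivity)]
    ring_nf
  have hgood := (hm.ae_tendsto_setLAverage hu).and hP
  -- Both `z` and `y` are compared with the mean over `B` of `‖u - v‖` for the choice `v = u y`, a
  -- function that vanishes at `y` and equals `‖u z - u y‖` at `z`.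
  have hpair : ∀ᵐ y ∂m, y ∈ B → ∀ᵐ z ∂m, z ∈ B → ‖u z - u y‖ₑ ≤ I z + I y := by
    filter_upwards [hgood] with y hy hyB
    filter_upwards [hgood] with z hz hzB
    have h1 := hm.edist_norm_sub_average_le hu hy.2 (fun δ => hy.1 δ) hr hyB (u y)
    have h2 := hm.edist_norm_sub_average_le hu hz.2 (fun δ => hz.1 δ) hr hzB (u y)
    calc ‖u z - u y‖ₑ = edist ‖u z - u y‖ ‖u y - u y‖ := by
          rw [edist_eq_enorm_sub, sub_self, norm_zero, sub_zero, enorm_norm]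
      _ ≤ _ := edist_triangle_right _ _ _
      _ ≤ I z + I y := add_le_add h2 h1
  -- Averaging the pairwise bound over `z`; the average over `y` follows below, so that the mean of
  -- `I` enters twice.
  have hpt : ∀ᵐ y ∂m, y ∈ B → ‖u y - ⨍ z in B, u z ∂m‖ₑ ≤ I y + ⨍⁻ z in B, I z ∂m := by
    filter_upwards [hpair] with y hy hyB
    rw [← edist_eq_enorm_sub, edist_comm, edist_eq_enorm_sub, add_comm]
    exact (enorm_setAverage_sub_le hB0 hBt hu.integrableOn _).trans
      (setLAverage_le_add hB0 hBt (hy hyB) hBm)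
  refine (setLAverage_le_add hB0 hBt hpt hBm).trans ?_
  refine (add_le_add hIB hIB).trans_eq ?_
  rw [ENNReal.mul_rpow_of_nonneg _ _ hp0.le, ENNReal.ofReal_mul (by norm_num)]
  push_cast
  rw [ENNReal.coe_rpow_of_nonneg _ hp0.le]
  push_cast
  rw [show ENNReal.ofReal 4 = 4 by simp]
  ring

end IsDoublingWith

/-! ### Convergence of dyadic means, the boundary potential, and existence of the trace. -/

namespace IsDoublingWith

section Pointwise

variable {Y : Type*} [PseudoMetricSpace Y] [MeasurableSpace Y]
  {m : Measure Y} {C : ℝ≥0} {V : Type*} [NormedAddCommGroup V]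

/-- If the mean value of `f` over the balls `B(x, r₀ / 2 ^ k)` tends to `0`, then so do the mean
values over all balls centred at `x`. -/
theorem tendsto_setLAverage_of_tendsto_dyadic (hm : IsDoublingWith m C) [IsFiniteMeasure m]
    {f : Y → ℝ≥0∞} {x : Y} {r₀ : ℝ} (hr₀ : 0 < r₀)
    (hf : Tendsto (fun k : ℕ => ⨍⁻ y in Metric.ball x (r₀ / 2 ^ k), f y ∂m) atTop (𝓝 0)) :
    Tendsto (fun r : ℝ => ⨍⁻ y in Metric.ball x r, f y ∂m) (𝓝[>] 0) (𝓝 0) := by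
  have hf' := ENNReal.Tendsto.const_mul (a := (C : ℝ≥0∞)) hf (Or.inr ENNReal.coe_ne_top)
  rw [mul_zero, ENNReal.tendsto_nhds_zero] at hf'
  rw [ENNReal.tendsto_nhds_zero]
  intro ε hε
  obtain ⟨n₀, hn₀⟩ := eventually_atTop.1 (hf' ε hε)
  have hpos : 0 < r₀ / 2 ^ n₀ := by positivity
  filter_upwards [Ioo_mem_nhdsGT hpos] with r hr
  have hrr : r ≤ r₀ := hr.2.le.trans (div_le_self hr₀.le (one_le_pow₀ (by norm_num)))
  -- The dyadic radius with `r₀ / 2 ^ (n + 1) < r ≤ r₀ / 2 ^ n`; the dyadic ball is at most twice as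
  -- large, so one doubling compares the averages.
  obtain ⟨n, hn1, hn2⟩ := exists_nat_pow_near_of_lt_one (x := r / r₀) (y := (1 / 2 : ℝ))
    (div_pos hr.1 hr₀) ((div_le_one hr₀).2 hrr) (by norm_num) (by norm_num)
  have hn1' : r₀ / 2 ^ (n + 1) < r := by
    rw [lt_div_iff₀ hr₀, one_div, inv_pow] at hn1
    rwa [div_eq_mul_inv, mul_comm]
  have hn2' : r ≤ r₀ / 2 ^ n := by
    rw [div_le_iff₀ hr₀, one_div, inv_pow] at hn2
    rwa [div_eq_mul_inv, mul_comm]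
  have hnn : n₀ ≤ n := by
    by_contra! hlt
    have h1 : (2 : ℝ) ^ (n + 1) ≤ 2 ^ n₀ := pow_le_pow_right₀ (by norm_num) hlt
    have h2 : r₀ / 2 ^ n₀ ≤ r₀ / 2 ^ (n + 1) := by gcongr
    linarith [hr.2]
  refine le_trans ?_ (hn₀ n hnn)
  refine setLAverage_le_mul_setLAverage (Metric.ball_subset_ball hn2') ?_
    (hm.pos x r hr.1) (measure_ne_top _ _) f
  refine (measure_mono (Metric.ball_subset_ball ?_)).trans (hm.doubling x r hr.1)
  have : r₀ / 2 ^ n = 2 * (r₀ / 2 ^ (n + 1)) := by rw [pow_succ]; field_simp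
  linarith

/-- A point at which the dyadic mean oscillations are summable is a point of convergence of the
means. -/
theorem exists_limit_of_tsum_oscillation [OpensMeasurableSpace Y] (hm : IsDoublingWith m C)
    [IsFiniteMeasure m]
    [NormedSpace ℝ V] [CompleteSpace V] {u : Y → V} (hu : Integrable u m) {x : Y} {r₀ : ℝ}
    (hr₀ : 0 < r₀)
    (hfin : ∑' k : ℕ, ⨍⁻ y in Metric.ball x (r₀ / 2 ^ k),
      ‖u y - ⨍ z in Metric.ball x (r₀ / 2 ^ k), u z ∂m‖ₑ ∂m ≠ ∞) :
    ∃ v : V, Tendsto (fun k : ℕ => ⨍ z in Metric.ball x (r₀ / 2 ^ k), u z ∂m) atTop (𝓝 v) ∧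
      Tendsto (fun r : ℝ => ⨍⁻ y in Metric.ball x r, ‖u y - v‖ₑ ∂m) (𝓝[>] 0) (𝓝 0) ∧
      edist (⨍ z in Metric.ball x r₀, u z ∂m) v ≤
        C * ∑' k : ℕ, ⨍⁻ y in Metric.ball x (r₀ / 2 ^ k),
          ‖u y - ⨍ z in Metric.ball x (r₀ / 2 ^ k), u z ∂m‖ₑ ∂m := by
  set a : ℕ → V := fun k => ⨍ z in Metric.ball x (r₀ / 2 ^ k), u z ∂m with ha
  set d : ℕ → ℝ≥0∞ := fun k => ⨍⁻ y in Metric.ball x (r₀ / 2 ^ k), ‖u y - a k‖ₑ ∂m with hd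
  have hstep : ∀ k, edist (a k) (a (k + 1)) ≤ C * d k :=
    fun k => hm.edist_average_ball_succ_le hu x hr₀ k
  have hsum : ∑' k, C * d k ≠ ∞ := by
    rw [ENNReal.tsum_mul_left]
    exact ENNReal.mul_ne_top ENNReal.coe_ne_top hfin
  obtain ⟨v, hv⟩ := cauchySeq_tendsto_of_complete
    (cauchySeq_of_edist_le_of_tsum_ne_top _ hstep hsum)
  refine ⟨v, hv, hm.tendsto_setLAverage_of_tendsto_dyadic hr₀ ?_, ?_⟩
  · have hlim : Tendsto (fun k => d k + edist (a k) v) atTop (𝓝 0) := by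
      have := (ENNReal.tendsto_atTop_zero_of_tsum_ne_top hfin).add
        (tendsto_iff_edist_tendsto_0.1 hv)
      rwa [add_zero] at this
    refine tendsto_of_tendsto_of_tendsto_of_le_of_le tendsto_const_nhds hlim
      (fun _ => zero_le) fun k => ?_
    refine setLAverage_le_add (hm.pos _ _ (by positivity)) (measure_ne_top _ _)
      (Eventually.of_forall fun y _ => ?_) Metric.isOpen_ball.measurableSet
    rw [← edist_eq_enorm_sub, ← edist_eq_enorm_sub]
    exact edist_triangle _ _ _
  · have h := edist_le_tsum_of_edist_le_of_tendsto₀ _ hstep hv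
    rw [ENNReal.tsum_mul_left] at h
    simpa [ha] using h

end Pointwise

variable {Y : Type*} [PseudoMetricSpace Y] [MeasurableSpace Y] [BorelSpace Y]
  [SecondCountableTopology Y] {m : Measure Y} {C : ℝ≥0} {V : Type*} [NormedAddCommGroup V]
  {Z : Type*} [MeasurableSpace Z]

/-- A weighted dyadic sum of fractional averages, the boundary potential of `G`. -/
noncomputable def boundaryPotential (m : Measure Y) (p : ℝ) (φ : ℝ → ℝ≥0∞) (t₀ : ℝ)
    (G : Y → ℝ≥0∞) (x : Y) : ℝ≥0∞ :=
  ∑' k : ℕ, φ (t₀ / 2 ^ k) * (ENNReal.ofReal ((t₀ / 2 ^ k) ^ p) *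
    ⨍⁻ y in Metric.ball x (t₀ / 2 ^ k), G y ∂m) ^ (1 / p)

theorem measurable_boundaryPotential [SFinite m] {ι : Z → Y} (hι : Measurable ι) (p : ℝ)
    (φ : ℝ → ℝ≥0∞) (t₀ : ℝ) {G : Y → ℝ≥0∞} (hG : Measurable G) :
    Measurable fun z => boundaryPotential m p φ t₀ G (ι z) :=
  Measurable.tsum fun _ =>
    (((measurable_setLAverage_ball hι _ hG).const_mul _).pow_const _).const_mul _

/-- The measure `H` is upper codimension-`p` regular with respect to `m` at scales up to `t₀`. -/
def CodimRegularUpTo (m : Measure Y) (H : Measure Z) (ι : Z → Y) (p : ℝ) (K : ℝ≥0∞)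
    (t₀ : ℝ) : Prop :=
  ∀ t, 0 < t → t ≤ t₀ → ∀ y z, dist (ι z) y < t →
    H (ι ⁻¹' Metric.ball y t) ≤ K / ENNReal.ofReal (t ^ p) * m (Metric.ball (ι z) t)

theorem lintegral_setLAverage_le_of_codimRegular (hm : IsDoublingWith m C) [IsFiniteMeasure m]
    {H : Measure Z} [IsFiniteMeasure H] {ι : Z → Y} (hι : Measurable ι) {p : ℝ} {K : ℝ≥0∞}
    {t₀ : ℝ} (hH : CodimRegularUpTo m H ι p K t₀) {t : ℝ} (ht : 0 < t) (htt : t ≤ t₀)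
    {G : Y → ℝ≥0∞} (hG : Measurable G) :
    ∫⁻ z, ⨍⁻ y in Metric.ball (ι z) t, G y ∂m ∂H ≤
      K / ENNReal.ofReal (t ^ p) * ∫⁻ y, G y ∂m :=
  lintegral_setLAverage_ball_le hι (fun _ => hm.pos _ _ ht) (fun _ => measure_ne_top _ _)
    (hH t ht htt) hG

/-- After Jensen for the weights `φ (t₀ / 2 ^ k)`, the factor `t ^ p` of each term cancels the `t ^
(-p)` of the codimension bound exactly. All scales thus contribute the same `K * ∫ G`, and
summability of `φ` suffices. -/
theorem lintegral_boundaryPotential_rpow_le (hm : IsDoublingWith m C) [IsFiniteMeasure m]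
    {H : Measure Z} [IsFiniteMeasure H] {ι : Z → Y} (hι : Measurable ι) {p : ℝ} (hp : 1 < p)
    {K : ℝ≥0∞} {t₀ : ℝ} (ht₀ : 0 < t₀) (hH : CodimRegularUpTo m H ι p K t₀) (φ : ℝ → ℝ≥0∞)
    {G : Y → ℝ≥0∞} (hG : Measurable G) :
    ∫⁻ z, boundaryPotential m p φ t₀ G (ι z) ^ p ∂H ≤
      (∑' k : ℕ, φ (t₀ / 2 ^ k)) ^ p * (K * ∫⁻ y, G y ∂m) := by
  have hp0 : 0 < p := by linarith
  set W := ∑' k : ℕ, φ (t₀ / 2 ^ k) with hW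
  have hmeas : ∀ k : ℕ, Measurable fun z => ENNReal.ofReal ((t₀ / 2 ^ k) ^ p) *
      ⨍⁻ y in Metric.ball (ι z) (t₀ / 2 ^ k), G y ∂m :=
    fun k => (measurable_setLAverage_ball hι _ hG).const_mul _
  have hterm : ∀ k : ℕ, ∫⁻ z, ENNReal.ofReal ((t₀ / 2 ^ k) ^ p) *
      ⨍⁻ y in Metric.ball (ι z) (t₀ / 2 ^ k), G y ∂m ∂H ≤ K * ∫⁻ y, G y ∂m := by
    intro k
    have hpos : 0 < t₀ / 2 ^ k := by positivity
    rw [lintegral_const_mul _ (measurable_setLAverage_ball hι _ hG)]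
    refine (mul_le_mul_right (hm.lintegral_setLAverage_le_of_codimRegular hι hH hpos
      (div_le_self ht₀.le (one_le_pow₀ (by norm_num))) hG) _).trans_eq ?_
    rw [← mul_assoc, ENNReal.mul_div_cancel
      (by rw [ne_eq, ENNReal.ofReal_eq_zero, not_le]; positivity) ENNReal.ofReal_ne_top]
  calc ∫⁻ z, boundaryPotential m p φ t₀ G (ι z) ^ p ∂H
      ≤ ∫⁻ z, W ^ (p - 1) * ∑' k : ℕ, φ (t₀ / 2 ^ k) * (ENNReal.ofReal ((t₀ / 2 ^ k) ^ p) *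
          ⨍⁻ y in Metric.ball (ι z) (t₀ / 2 ^ k), G y ∂m) ∂H := by
        refine lintegral_mono fun z => (tsum_mul_rpow_le hp _ _).trans_eq ?_
        simp_rw [← ENNReal.rpow_mul, one_div_mul_cancel hp0.ne', ENNReal.rpow_one]
        rfl
    _ = W ^ (p - 1) * ∑' k : ℕ, φ (t₀ / 2 ^ k) * ∫⁻ z, (ENNReal.ofReal ((t₀ / 2 ^ k) ^ p) *
          ⨍⁻ y in Metric.ball (ι z) (t₀ / 2 ^ k), G y ∂m) ∂H := by
        rw [lintegral_const_mul _ (Measurable.tsum fun k => (hmeas k).const_mul _),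
          lintegral_tsum fun k => ((hmeas k).const_mul _).aemeasurable]
        simp_rw [lintegral_const_mul _ (hmeas _)]
    _ ≤ W ^ (p - 1) * ∑' k : ℕ, φ (t₀ / 2 ^ k) * (K * ∫⁻ y, G y ∂m) := by
        gcongr with k
        exact hterm k
    _ = W ^ p * (K * ∫⁻ y, G y ∂m) := by
        rw [ENNReal.tsum_mul_right, ← hW, ← mul_assoc]
        congr 1
        have := ENNReal.rpow_add_of_nonneg (x := W) (p - 1) 1 (by linarith) zero_le_one
        rw [sub_add_cancel, ENNReal.rpow_one] at this
        exact this.symm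

/-- Jensen's inequality followed by the codimension bound. The power of `t` is not compensated here,
which is harmless since only one scale is used, the start of the telescoping. -/
theorem lintegral_enorm_average_rpow_le (hm : IsDoublingWith m C) [IsFiniteMeasure m]
    {H : Measure Z} [IsFiniteMeasure H] {ι : Z → Y} (hι : Measurable ι) {p : ℝ} (hp : 1 < p)
    {K : ℝ≥0∞} {t₀ : ℝ} (hH : CodimRegularUpTo m H ι p K t₀) {t : ℝ} (ht : 0 < t) (htt : t ≤ t₀)
    [NormedSpace ℝ V] [CompleteSpace V] {u : Y → V} (hu : Integrable u m) :
    ∫⁻ z, ‖⨍ y in Metric.ball (ι z) t, u y ∂m‖ₑ ^ p ∂H ≤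
      K / ENNReal.ofReal (t ^ p) * ∫⁻ y, ‖u y‖ₑ ^ p ∂m := by
  have hp0 : 0 < p := by linarith
  set u' := hu.1.mk u
  have hu' : u =ᵐ[m] u' := hu.1.ae_eq_mk
  have hu'm : Measurable fun y => ‖u' y‖ₑ ^ p :=
    hu.1.stronglyMeasurable_mk.enorm.pow_const _
  rw [lintegral_congr_ae (hu'.mono fun y hy => by simp only [hy] :
    (fun y => ‖u y‖ₑ ^ p) =ᵐ[m] fun y => ‖u' y‖ₑ ^ p)]
  refine le_trans (lintegral_mono fun z => ?_)
    (hm.lintegral_setLAverage_le_of_codimRegular hι hH ht htt hu'm)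
  have h1 := enorm_setAverage_sub_le (hm.pos (ι z) t ht) (measure_ne_top m _)
    hu.integrableOn 0
  simp only [sub_zero] at h1
  refine (ENNReal.rpow_le_rpow h1 hp0.le).trans ((setLAverage_rpow_le hp (hm.pos _ _ ht)
    (measure_ne_top _ _) hu.1.enorm.restrict).trans_eq ?_)
  exact laverage_congr (ae_restrict_of_ae (hu'.mono fun y hy => by simp only [hy]))

/-- Existence and integrability of the trace, from a Poincaré inequality on the balls centred at
`ι z` and a weight improving its right hand side. -/
theorem exists_trace (hm : IsDoublingWith m C) [IsFiniteMeasure m]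
    {H : Measure Z} [IsFiniteMeasure H] {ι : Z → Y} (hι : Measurable ι) {p : ℝ} (hp : 1 < p)
    {K : ℝ≥0} {t₀ : ℝ} (ht₀ : 0 < t₀) (hH : CodimRegularUpTo m H ι p K t₀) {φ : ℝ → ℝ≥0∞}
    (hφ : ∑' k : ℕ, φ (t₀ / 2 ^ k) ≠ ∞) [NormedSpace ℝ V] [CompleteSpace V]
    {u : Y → V} (hu : Integrable u m) {G G' : Y → ℝ≥0∞} (hG' : Measurable G')
    (hG'i : ∫⁻ y, G' y ∂m ≠ ∞) {P : ℝ≥0} {N : ℕ}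
    (hP : ∀ x : Y, ∀ r > 0,
      ⨍⁻ y in Metric.ball x r, ‖u y - ⨍ z in Metric.ball x r, u z ∂m‖ₑ ∂m ≤
        P * ENNReal.ofReal r * (⨍⁻ y in Metric.ball x (2 ^ N * r), G y ∂m) ^ (1 / p))
    (hGG' : ∀ z t, 0 < t → t ≤ t₀ → (⨍⁻ y in Metric.ball (ι z) t, G y ∂m) ^ (1 / p) ≤
      φ t * (⨍⁻ y in Metric.ball (ι z) t, G' y ∂m) ^ (1 / p)) :
    ∃ f : Z → V, AEStronglyMeasurable f H ∧
      (∀ᵐ z ∂H, Tendsto (fun r : ℝ => ⨍⁻ y in Metric.ball (ι z) r, ‖u y - f z‖ₑ ∂m)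
        (𝓝[>] 0) (𝓝 0)) ∧
      (∫⁻ z, ‖f z‖ₑ ^ p ∂H) ^ (1 / p) ≤
        (K / ENNReal.ofReal ((t₀ / 2 ^ N) ^ p)) ^ (1 / p) * (∫⁻ y, ‖u y‖ₑ ^ p ∂m) ^ (1 / p) +
        C * (P * ((∑' k : ℕ, φ (t₀ / 2 ^ k)) * ((K : ℝ≥0∞) ^ (1 / p) *
          (∫⁻ y, G' y ∂m) ^ (1 / p)))) := by
  have hp0 : 0 < p := by linarith
  have hp1 : 0 < 1 / p := by positivity
  -- The starting radius is chosen so that the enlarged balls of the Poincaré inequality have radii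
  -- `t₀ / 2 ^ k`, the scales at which `φ` and the regularity of `H` are controlled.
  set r₀ := t₀ / 2 ^ N with hr₀
  have hr₀pos : 0 < r₀ := by positivity
  have hr₀le : r₀ ≤ t₀ := div_le_self ht₀.le (one_le_pow₀ (by norm_num))
  set S : Z → ℝ≥0∞ := fun z => boundaryPotential m p φ t₀ G' (ι z) with hS
  have hSm : Measurable S := measurable_boundaryPotential hι p φ t₀ hG'
  have hSp := hm.lintegral_boundaryPotential_rpow_le hι hp ht₀ hH φ hG'
  have hSfin : ∀ᵐ z ∂H, S z < ∞ := by
    have hne : ∫⁻ z, S z ^ p ∂H ≠ ∞ := by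
      refine ne_top_of_le_ne_top ?_ hSp
      exact ENNReal.mul_ne_top (ENNReal.rpow_ne_top_of_nonneg hp0.le hφ)
        (ENNReal.mul_ne_top ENNReal.coe_ne_top hG'i)
    filter_upwards [ae_lt_top (hSm.pow_const p) hne] with z hz
    exact (ENNReal.rpow_lt_top_iff_of_pos hp0).1 hz
  have hosc : ∀ z, ∑' k : ℕ, ⨍⁻ y in Metric.ball (ι z) (r₀ / 2 ^ k),
      ‖u y - ⨍ t in Metric.ball (ι z) (r₀ / 2 ^ k), u t ∂m‖ₑ ∂m ≤ P * S z := by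
    intro z
    rw [hS]
    simp only [boundaryPotential]
    rw [← ENNReal.tsum_mul_left]
    refine ENNReal.tsum_le_tsum fun k => ?_
    have hpos : 0 < t₀ / 2 ^ k := by positivity
    have hle : t₀ / 2 ^ k ≤ t₀ := div_le_self ht₀.le (one_le_pow₀ (by norm_num))
    have h1 := hP (ι z) (r₀ / 2 ^ k) (by positivity)
    have h2 : 2 ^ N * (r₀ / 2 ^ k) = t₀ / 2 ^ k := by rw [hr₀]; field_simp
    rw [h2] at h1
    have h3 : ENNReal.ofReal (r₀ / 2 ^ k) ≤ ENNReal.ofReal ((t₀ / 2 ^ k) ^ p) ^ (1 / p) := by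
      rw [← ENNReal.ofReal_rpow_of_nonneg hpos.le hp0.le, ← ENNReal.rpow_mul,
        mul_one_div_cancel hp0.ne', ENNReal.rpow_one]
      exact ENNReal.ofReal_le_ofReal (by gcongr)
    rw [ENNReal.mul_rpow_of_nonneg _ _ hp1.le]
    calc _ ≤ _ := h1
      _ ≤ P * ENNReal.ofReal ((t₀ / 2 ^ k) ^ p) ^ (1 / p) *
          (φ (t₀ / 2 ^ k) * (⨍⁻ y in Metric.ball (ι z) (t₀ / 2 ^ k), G' y ∂m) ^ (1 / p)) := by
        gcongr
        exact hGG' z _ hpos hle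
      _ = _ := by ring
  set a : ℕ → Z → V := fun k z => ⨍ y in Metric.ball (ι z) (r₀ / 2 ^ k), u y ∂m with ha
  have ham : ∀ k, StronglyMeasurable (a k) := fun k =>
    stronglyMeasurable_setAverage_ball hι _ hu.1
  -- The value is irrelevant on the null set where `S` is infinite. The chosen `f` is almost
  -- everywhere the limit of the measurable functions `a k`, hence almost everywhere strongly
  -- measurable.
  have hex : ∀ z, ∃ v : V, S z < ∞ → Tendsto (fun k => a k z) atTop (𝓝 v) ∧
      Tendsto (fun r : ℝ => ⨍⁻ y in Metric.ball (ι z) r, ‖u y - v‖ₑ ∂m) (𝓝[>] 0) (𝓝 0) ∧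
      edist (⨍ y in Metric.ball (ι z) r₀, u y ∂m) v ≤ C * (P * S z) := by
    intro z
    by_cases hz : S z < ∞
    · obtain ⟨v, h1, h2, h3⟩ := hm.exists_limit_of_tsum_oscillation hu (x := ι z) hr₀pos
        (ne_top_of_le_ne_top (ENNReal.mul_ne_top ENNReal.coe_ne_top hz.ne) (hosc z))
      exact ⟨v, fun _ => ⟨h1, h2, h3.trans (mul_le_mul_right (hosc z) _)⟩⟩
    · exact ⟨0, fun h => absurd h hz⟩
  choose f hf using hex
  refine ⟨f, aestronglyMeasurable_of_tendsto_ae atTop (fun k => (ham k).aestronglyMeasurable)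
    (hSfin.mono fun z hz => (hf z hz).1), hSfin.mono fun z hz => (hf z hz).2.1, ?_⟩
  set A : Z → ℝ≥0∞ := fun z => ‖⨍ y in Metric.ball (ι z) r₀, u y ∂m‖ₑ with hA
  have hAm : Measurable A := (stronglyMeasurable_setAverage_ball hι r₀ hu.1).enorm
  have hAp := hm.lintegral_enorm_average_rpow_le hι hp hH hr₀pos hr₀le hu
  have hfle : ∀ᵐ z ∂H, ‖f z‖ₑ ^ p ≤ (A + fun z => C * (P * S z)) z ^ p := by
    filter_upwards [hSfin] with z hz
    refine ENNReal.rpow_le_rpow ?_ hp0.le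
    have h := edist_triangle_left (f z) 0 (⨍ y in Metric.ball (ι z) r₀, u y ∂m)
    rw [edist_zero_right, edist_zero_right, add_comm] at h
    exact h.trans (add_le_add_right (hf z hz).2.2 _)
  calc (∫⁻ z, ‖f z‖ₑ ^ p ∂H) ^ (1 / p)
      ≤ (∫⁻ z, (A + fun z => C * (P * S z)) z ^ p ∂H) ^ (1 / p) :=
        ENNReal.rpow_le_rpow (lintegral_mono_ae hfle) hp1.le
    _ ≤ (∫⁻ z, A z ^ p ∂H) ^ (1 / p) + (∫⁻ z, (C * (P * S z)) ^ p ∂H) ^ (1 / p) :=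
        ENNReal.lintegral_Lp_add_le hAm.aemeasurable
          ((hSm.const_mul _).const_mul _).aemeasurable hp.le
    _ ≤ _ := by
      refine add_le_add ?_ ?_
      · rw [← ENNReal.mul_rpow_of_nonneg _ _ hp1.le]
        exact ENNReal.rpow_le_rpow hAp hp1.le
      · simp_rw [ENNReal.mul_rpow_of_nonneg _ _ hp0.le]
        rw [lintegral_const_mul _ ((hSm.pow_const _).const_mul _),
          lintegral_const_mul _ (hSm.pow_const _)]
        rw [ENNReal.mul_rpow_of_nonneg _ _ hp1.le, ENNReal.mul_rpow_of_nonneg _ _ hp1.le,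
          ← ENNReal.rpow_mul, ← ENNReal.rpow_mul, mul_one_div_cancel hp0.ne', ENNReal.rpow_one,
          ENNReal.rpow_one]
        gcongr
        refine (ENNReal.rpow_le_rpow hSp hp1.le).trans_eq ?_
        rw [ENNReal.mul_rpow_of_nonneg _ _ hp1.le, ENNReal.mul_rpow_of_nonneg _ _ hp1.le,
          ← ENNReal.rpow_mul, mul_one_div_cancel hp0.ne', ENNReal.rpow_one]

end IsDoublingWith

/-! ### Replacing weak upper gradients by upper gradients. -/

section WeakUpperGradients

/-- The map `‖· - v‖` is 1-Lipschitz. This is the passage from Banach valued functions to the real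
valued ones of the Poincaré inequality. -/
theorem IsUpperGradient.norm_sub_const {X : Type*} [MetricSpace X] [MeasurableSpace X]
    {V : Type*} [NormedAddCommGroup V] {Ω : Set X} {u : X → V} {g : X → ℝ≥0∞}
    (hg : IsUpperGradient Ω u g) (v : V) : IsUpperGradient Ω (fun x => ‖u x - v‖) g := by
  refine ⟨hg.1, fun γ => le_trans ?_ (hg.2 γ)⟩
  rw [edist_eq_enorm_sub, edist_eq_enorm_sub, enorm_le_iff_norm_le, Real.norm_eq_abs]
  have := abs_norm_sub_norm_le (u (γ.toFun γ.b) - v) (u (γ.toFun γ.a) - v)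
  rwa [sub_sub_sub_cancel_right] at this

variable {X : Type*} [MetricSpace X] [MeasurableSpace X] [BorelSpace X]

theorem RectifiableCurve.lineIntegral_tsum {Ω : Set X} (γ : RectifiableCurve Ω)
    {h : ℕ → X → ℝ≥0∞} (hh : ∀ n, Measurable (h n)) :
    γ.lineIntegral (fun x => ∑' n, h n x) = ∑' n, γ.lineIntegral (h n) :=
  lintegral_tsum fun n =>
    (hh n).comp_aemeasurable (γ.continuousOn_arcParam.aemeasurable measurableSet_Icc)

/-- A curve family of modulus zero has an admissible function of small norm whose integral along
each curve of the family is infinite. -/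
theorem exists_lineIntegral_eq_top_of_curveModulus_eq_zero {Ω : Set X} {p : ℝ} (hp : 1 < p)
    {ν : Measure X} {Γ : Set (RectifiableCurve Ω)} (hΓ : curveModulus Ω p ν Γ = 0) {ε : ℝ≥0∞}
    (hε : ε ≠ 0) :
    ∃ h : X → ℝ≥0∞, Measurable h ∧ (∀ γ ∈ Γ, γ.lineIntegral h = ∞) ∧
      (∫⁻ x in Ω, h x ^ p ∂ν) ^ (1 / p) ≤ ε := by
  have hp0 : 0 < p := by linarith
  set S : ℝ≥0∞ := ∑' n : ℕ, (2⁻¹ : ℝ≥0∞) ^ n with hS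
  have hSt : S ≠ ∞ := by
    rw [hS, ENNReal.tsum_geometric]
    simp
  set c : ℕ → ℝ≥0∞ := fun n => ((2 : ℝ≥0∞) ^ n) ^ p with hc
  have hct : ∀ n, c n ≠ ∞ := fun n =>
    ENNReal.rpow_ne_top_of_nonneg hp0.le (ENNReal.pow_ne_top ENNReal.ofNat_ne_top)
  have hc0 : ∀ n, c n ≠ 0 := fun n => by simp [hc]
  -- Chosen so that `S ^ p * η ≤ ε ^ p` at the end of the estimate. The admissible functions `h n`
  -- have energy at most `η / 2 ^ (n p)`, and each contributes at least 1 to every line integral of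
  -- their sum.
  set η : ℝ≥0∞ := (ε / S) ^ p with hη
  have hη0 : η ≠ 0 := by
    rw [hη, ne_eq, ENNReal.rpow_eq_zero_iff_of_pos hp0]
    exact (ENNReal.div_pos hε hSt).ne'
  have hex : ∀ n, ∃ h : X → ℝ≥0∞, Measurable h ∧ (∀ γ ∈ Γ, 1 ≤ γ.lineIntegral h) ∧
      ∫⁻ x in Ω, h x ^ p ∂ν ≤ η / c n := by
    intro n
    have h1 := hΓ.trans_lt (ENNReal.div_pos hη0 (hct n))
    simp only [curveModulus, iInf_lt_iff] at h1
    obtain ⟨h, hm, hγ, hl⟩ := h1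
    exact ⟨h, hm, hγ, hl.le⟩
  choose h hm hγ hl using hex
  refine ⟨fun x => ∑' n, h n x, Measurable.tsum hm, fun γ hγΓ => ?_, ?_⟩
  · rw [γ.lineIntegral_tsum hm, ← top_le_iff, ← ENNReal.tsum_const_eq_top_of_ne_zero (α := ℕ)
      one_ne_zero]
    exact ENNReal.tsum_le_tsum fun n => hγ n γ hγΓ
  · have hpt : ∀ x, (∑' n, h n x) ^ p ≤
        S ^ (p - 1) * ∑' n, (2⁻¹ : ℝ≥0∞) ^ n * (c n * h n x ^ p) := by
      intro x
      -- Write `h n` as `2⁻¹ ^ n * (2 ^ n * h n)` and apply Jensen with the geometric weights.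
      have h1 := tsum_mul_rpow_le hp (fun n => (2⁻¹ : ℝ≥0∞) ^ n) (fun n => 2 ^ n * h n x)
      simp_rw [ENNReal.mul_rpow_of_nonneg _ _ hp0.le] at h1
      refine le_trans (le_of_eq ?_) h1
      congr 2
      ext n
      rw [← mul_assoc, ← mul_pow, ENNReal.inv_mul_cancel two_ne_zero ENNReal.ofNat_ne_top,
        one_pow, one_mul]
    have hI : ∫⁻ x in Ω, (∑' n, h n x) ^ p ∂ν ≤ ε ^ p := by
      calc ∫⁻ x in Ω, (∑' n, h n x) ^ p ∂ν
          ≤ ∫⁻ x in Ω, S ^ (p - 1) * ∑' n, (2⁻¹ : ℝ≥0∞) ^ n * (c n * h n x ^ p) ∂ν :=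
            lintegral_mono hpt
        _ = S ^ (p - 1) * ∑' n, (2⁻¹ : ℝ≥0∞) ^ n * (c n * ∫⁻ x in Ω, h n x ^ p ∂ν) := by
            have hmp : ∀ n, Measurable fun x => c n * h n x ^ p := fun n =>
              ((hm n).pow_const _).const_mul _
            rw [lintegral_const_mul _ (Measurable.tsum fun n => (hmp n).const_mul _),
              lintegral_tsum fun n => ((hmp n).const_mul _).aemeasurable]
            simp_rw [lintegral_const_mul _ (hmp _), lintegral_const_mul _ ((hm _).pow_const p)]
        _ ≤ S ^ (p - 1) * ∑' n, (2⁻¹ : ℝ≥0∞) ^ n * η := by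
            gcongr with n
            refine (mul_le_mul_right (hl n) _).trans_eq ?_
            exact ENNReal.mul_div_cancel (hc0 n) (hct n)
        _ = S ^ p * η := by
            rw [ENNReal.tsum_mul_right, ← hS, ← mul_assoc]
            congr 1
            have := ENNReal.rpow_add_of_nonneg (x := S) (p - 1) 1 (by linarith) zero_le_one
            rw [sub_add_cancel, ENNReal.rpow_one] at this
            exact this.symm
        _ ≤ ε ^ p := by
            rw [hη, ← ENNReal.mul_rpow_of_nonneg _ _ hp0.le]
            exact ENNReal.rpow_le_rpow ENNReal.mul_div_le hp0.le
    rw [one_div, ENNReal.rpow_inv_le_iff hp0]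
    exact hI

variable {V : Type*} [NormedAddCommGroup V]

/-- Add to `g` a function of small norm with infinite integral along every exceptional curve; the
inequality then holds trivially on these. The Poincaré hypothesis speaks only of genuine upper
gradients. -/
theorem IsWeakUpperGradient.exists_isUpperGradient {Ω : Set X} {p : ℝ} (hp : 1 < p)
    {ν : Measure X} {u : X → V} {g : X → ℝ≥0∞} (hg : IsWeakUpperGradient Ω p ν u g) {ε : ℝ≥0∞}
    (hε : ε ≠ 0) :
    ∃ g', IsUpperGradient Ω u g' ∧
      (∫⁻ x in Ω, g' x ^ p ∂ν) ^ (1 / p) ≤ (∫⁻ x in Ω, g x ^ p ∂ν) ^ (1 / p) + ε := by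
  obtain ⟨h, hm, hγ, hl⟩ := exists_lineIntegral_eq_top_of_curveModulus_eq_zero hp hg.2 hε
  refine ⟨fun x => g x + h x, ⟨hg.1.add hm, fun γ => ?_⟩, ?_⟩
  · rw [γ.lineIntegral_add hg.1]
    by_cases hγ' : edist (u (γ.toFun γ.b)) (u (γ.toFun γ.a)) ≤ γ.lineIntegral g
    · exact hγ'.trans le_self_add
    · rw [hγ γ hγ', add_top]
      exact le_top
  · exact (ENNReal.lintegral_Lp_add_le hg.1.aemeasurable hm.aemeasurable hp.le).trans
      (add_le_add_right hl _)

theorem exists_isUpperGradient_le_dirichletSeminorm_add [NormedSpace ℝ V] {Ω : Set X} {p : ℝ}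
    (hp : 1 < p) {ν : Measure X} {u : X → V} (hfin : dirichletSeminorm Ω p ν u ≠ ∞) {ε : ℝ≥0∞}
    (hε : ε ≠ 0) :
    ∃ g, IsUpperGradient Ω u g ∧
      (∫⁻ x in Ω, g x ^ p ∂ν) ^ (1 / p) ≤ dirichletSeminorm Ω p ν u + ε := by
  have hε2 : ε / 2 ≠ 0 := (ENNReal.half_pos hε).ne'
  have h1 := ENNReal.lt_add_right hfin hε2
  nth_rewrite 1 [dirichletSeminorm] at h1
  simp only [iInf_lt_iff] at h1
  obtain ⟨g, hg, hgl⟩ := h1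
  obtain ⟨g', hg', hgl'⟩ := hg.exists_isUpperGradient hp hε2
  refine ⟨g', hg', hgl'.trans ((add_le_add_left hgl.le _).trans_eq ?_)⟩
  rw [add_assoc, ENNReal.add_halves]

end WeakUpperGradients

/-! ### The weight `ω` and its Dini condition. -/

section Weights

/-- Nothing is assumed of `ω` on `(-∞, 0]`, so `ω` itself need not be Borel; truncation is harmless
because points of `Ω` have positive distance from a nonempty boundary. -/
theorem measurable_indicator_of_antitoneOn {ω : ℝ → ℝ} (hω : AntitoneOn ω (Ioi 0)) :
    Measurable ((Ioi (0 : ℝ)).indicator ω) := by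
  refine measurable_of_restrict_of_restrict_compl (measurableSet_Ioi (a := (0 : ℝ))) ?_ ?_
  · have h : (Ioi (0 : ℝ)).domRestrict ((Ioi (0 : ℝ)).indicator ω) = (Ioi (0 : ℝ)).domRestrict ω :=
      funext fun t => indicator_of_mem t.2 ω
    have hanti : Antitone ((Ioi (0 : ℝ)).domRestrict ω) := fun a b hab => hω a.2 b.2 hab
    rw [h]
    exact hanti.measurable
  · have h : (Ioi (0 : ℝ))ᶜ.domRestrict ((Ioi (0 : ℝ)).indicator ω) = fun _ => 0 :=
      funext fun t => indicator_of_notMem t.2 ω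
    rw [h]
    exact measurable_const

/-- On `(s, 2s)` with `s = t₀ / 2 ^ k`, monotonicity gives `ω t ^ (-1 / θ) ≥ ω s ^ (-1 / θ)`, while
`1 / t ≥ 1 / (2s)`. Each term is therefore at most twice the integral over this interval. The
intervals are disjoint and lie in `(0, 1)` because `t₀ ≤ 1 / 2`. -/
theorem tsum_dyadic_ne_top {ω : ℝ → ℝ} {θ : ℝ} (hθ : 0 < θ) (hω_one : ∀ t > 0, 1 ≤ ω t)
    (hω_anti : AntitoneOn ω (Ioi 0))
    (hω_int : ∫⁻ t in Ioo (0 : ℝ) 1, ENNReal.ofReal (t⁻¹ * ω t ^ (-1 / θ)) < ∞) {t₀ : ℝ}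
    (ht₀ : 0 < t₀) (ht₁ : t₀ ≤ 1 / 2) :
    ∑' k : ℕ, ENNReal.ofReal (ω (t₀ / 2 ^ k) ^ (-1 / θ)) ≠ ∞ := by
  set f : ℕ → ℝ := fun k => 2 * t₀ / 2 ^ k with hf
  have hfs : ∀ k, f (k + 1) = t₀ / 2 ^ k := fun k => by simp only [hf, pow_succ]; field_simp
  have hfd : ∀ k, f k = 2 * (t₀ / 2 ^ k) := fun k => by simp only [hf]; ring
  have hanti : Antitone f := by
    refine antitone_nat_of_succ_le fun k => ?_
    rw [hfs, hfd]
    have : 0 < t₀ / 2 ^ k := by positivity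
    linarith
  have hdisj := hanti.pairwise_disjoint_on_Ioo_succ
  have hterm : ∀ k : ℕ, ENNReal.ofReal (ω (t₀ / 2 ^ k) ^ (-1 / θ)) ≤
      2 * ∫⁻ t in Ioo (f (Order.succ k)) (f k), ENNReal.ofReal (t⁻¹ * ω t ^ (-1 / θ)) := by
    intro k
    have hpos : 0 < t₀ / 2 ^ k := by positivity
    have hω0 : 0 ≤ ω (t₀ / 2 ^ k) ^ (-1 / θ) :=
      Real.rpow_nonneg (zero_le_one.trans (hω_one _ hpos)) _
    rw [Order.succ_eq_add_one, hfs, hfd]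
    set s := t₀ / 2 ^ k with hs
    calc ENNReal.ofReal (ω s ^ (-1 / θ))
        = 2 * (ENNReal.ofReal ((2 * s)⁻¹ * ω s ^ (-1 / θ)) * ENNReal.ofReal (2 * s - s)) := by
          rw [← ENNReal.ofReal_mul (by positivity), show (2 : ℝ≥0∞) = ENNReal.ofReal 2 by simp,
            ← ENNReal.ofReal_mul (by norm_num)]
          congr 1
          field_simp
          ring
      _ = 2 * ∫⁻ t in Ioo s (2 * s), ENNReal.ofReal ((2 * s)⁻¹ * ω s ^ (-1 / θ)) := by
          rw [setLIntegral_const, Real.volume_Ioo]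
      _ ≤ _ := by
          gcongr 2 * ?_
          refine setLIntegral_mono' measurableSet_Ioo fun t ht => ?_
          have ht0 : 0 < t := hpos.trans ht.1
          refine ENNReal.ofReal_le_ofReal (mul_le_mul ?_ ?_ hω0 (by positivity))
          · exact inv_anti₀ ht0 ht.2.le
          · refine Real.rpow_le_rpow_of_nonpos (zero_lt_one.trans_le (hω_one t ht0))
              (hω_anti (mem_Ioi.2 hpos) (mem_Ioi.2 ht0) ht.1.le) ?_
            rw [neg_div]
            exact neg_nonpos.2 (by positivity)
  refine ne_top_of_le_ne_top ?_ (ENNReal.tsum_le_tsum hterm)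
  rw [ENNReal.tsum_mul_left, ← lintegral_iUnion (fun _ => measurableSet_Ioo) hdisj]
  refine ENNReal.mul_ne_top ENNReal.ofNat_ne_top (ne_top_of_le_ne_top hω_int.ne
    (lintegral_mono_set (iUnion_subset fun k => Ioo_subset_Ioo ?_ ?_)))
  · simp only [hf]; positivity
  · refine (hanti (Nat.zero_le k)).trans ?_
    simp only [hf, pow_zero]
    linarith

end Weights

/-! ### Transfer to the closure of `Ω`, whose balls carry the mass of `B(x, r) ∩ Ω`. -/

section ClosureMeasure

variable {X : Type*} [MetricSpace X] [MeasurableSpace X] [BorelSpace X]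

/-- The measure `μ` restricted to `Ω`, as a measure on the closure of `Ω`. -/
noncomputable def closureMeasure (μ : Measure X) (Ω : Set X) : Measure (closure Ω) :=
  (μ.restrict Ω).comap Subtype.val

variable {μ : Measure X} {Ω : Set X}

theorem measurableEmbedding_closure (Ω : Set X) :
    MeasurableEmbedding (Subtype.val : closure Ω → X) :=
  .subtype_coe isClosed_closure.measurableSet

theorem map_closureMeasure :
    (closureMeasure μ Ω).map Subtype.val = μ.restrict Ω := by
  rw [closureMeasure, (measurableEmbedding_closure Ω).map_comap, Subtype.range_coe,
    Measure.restrict_restrict isClosed_closure.measurableSet,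
    inter_eq_self_of_subset_right subset_closure]

theorem map_closureMeasure_restrict_ball (x : closure Ω) (r : ℝ) :
    ((closureMeasure μ Ω).restrict (Metric.ball x r)).map Subtype.val =
      μ.restrict (Metric.ball (x : X) r ∩ Ω) := by
  rw [← Measure.restrict_restrict Metric.isOpen_ball.measurableSet,
    ← map_closureMeasure (μ := μ),
    (measurableEmbedding_closure Ω).restrict_map]
  rfl

theorem closureMeasure_ball (x : closure Ω) (r : ℝ) :
    closureMeasure μ Ω (Metric.ball x r) = μ (Metric.ball (x : X) r ∩ Ω) := by
  rw [← Measure.restrict_apply Metric.isOpen_ball.measurableSet, ← map_closureMeasure,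
    (measurableEmbedding_closure Ω).map_apply]
  rfl

theorem lintegral_closureMeasure (f : X → ℝ≥0∞) :
    ∫⁻ y, f y ∂(closureMeasure μ Ω) = ∫⁻ x in Ω, f x ∂μ := by
  rw [← map_closureMeasure, (measurableEmbedding_closure Ω).lintegral_map]

theorem ae_closureMeasure {P : X → Prop} :
    (∀ᵐ y : closure Ω ∂(closureMeasure μ Ω), P y) ↔ ∀ᵐ x ∂μ.restrict Ω, P x := by
  rw [← map_closureMeasure, (measurableEmbedding_closure Ω).ae_map_iff]

theorem integrable_closureMeasure {E : Type*} [NormedAddCommGroup E]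
    {u : X → E} (hu : IntegrableOn u Ω μ) :
    Integrable (fun y : closure Ω => u y) (closureMeasure μ Ω) := by
  rw [IntegrableOn, ← map_closureMeasure,
    (measurableEmbedding_closure Ω).integrable_map_iff] at hu
  exact hu

theorem setLAverage_closureMeasure (f : X → ℝ≥0∞) (x : closure Ω) (r : ℝ) :
    ⨍⁻ y in Metric.ball x r, f y ∂(closureMeasure μ Ω) =
      ⨍⁻ y in Metric.ball (x : X) r ∩ Ω, f y ∂μ := by
  rw [setLAverage_eq, setLAverage_eq, closureMeasure_ball,
    ← map_closureMeasure_restrict_ball, (measurableEmbedding_closure Ω).lintegral_map]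

theorem setAverage_closureMeasure {E : Type*} [NormedAddCommGroup E]
    [NormedSpace ℝ E] (f : X → E) (x : closure Ω) (r : ℝ) :
    ⨍ y in Metric.ball x r, f y ∂(closureMeasure μ Ω) =
      ⨍ y in Metric.ball (x : X) r ∩ Ω, f y ∂μ := by
  rw [setAverage_eq, setAverage_eq, Measure.real, Measure.real, closureMeasure_ball,
    ← map_closureMeasure_restrict_ball, (measurableEmbedding_closure Ω).integral_map]

theorem isDoublingWith_closureMeasure {C : ℝ≥0}
    (hC : ∀ x ∈ closure Ω, ∀ r > 0,
      0 < μ (Metric.ball x (2 * r) ∩ Ω) ∧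
      μ (Metric.ball x (2 * r) ∩ Ω) ≤ C * μ (Metric.ball x r ∩ Ω) ∧
      μ (Metric.ball x r ∩ Ω) < ∞) : IsDoublingWith (closureMeasure μ Ω) C where
  pos x r hr := by
    rw [closureMeasure_ball]
    have := (hC x x.2 (r / 2) (by positivity)).1
    rw [mul_div_cancel₀ r two_ne_zero] at this
    exact this.ne'
  finite x r hr := by
    rw [closureMeasure_ball]
    exact (hC x x.2 r hr).2.2.ne
  doubling x r hr := by
    rw [closureMeasure_ball, closureMeasure_ball]
    exact (hC x x.2 r hr).2.1

theorem isFiniteMeasure_closureMeasure (h : μ Ω ≠ ∞) :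
    IsFiniteMeasure (closureMeasure μ Ω) := by
  refine ⟨?_⟩
  have := lintegral_closureMeasure (μ := μ) (Ω := Ω) 1
  simp only [Pi.one_apply, lintegral_one, Measure.restrict_apply_univ] at this
  rw [this]
  exact h.lt_top

end ClosureMeasure

/-! ### Linearity and uniqueness of pointwise traces. -/

section TraceAlgebra

variable {X : Type*} [MetricSpace X] [MeasurableSpace X] {μ : Measure X} {Ω : Set X}
  {V : Type*} [NormedAddCommGroup V]

theorem HasTraceAt.add {u v : X → V}
    (hum : AEStronglyMeasurable u (μ.restrict Ω)) {x : X} {a b : V} (hu : HasTraceAt μ Ω u x a)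
    (hv : HasTraceAt μ Ω v x b) : HasTraceAt μ Ω (u + v) x (a + b) := by
  have h := Tendsto.add hu hv
  rw [add_zero] at h
  refine tendsto_of_tendsto_of_tendsto_of_le_of_le tendsto_const_nhds h (fun _ => zero_le)
    fun r => ?_
  simp only [setLAverage_eq]
  rw [← ENNReal.add_div, ← lintegral_add_left']
  · gcongr with y
    rw [Pi.add_apply, add_sub_add_comm]
    exact enorm_add_le _ _
  · exact ((hum.mono_measure (Measure.restrict_mono_set _ inter_subset_right)).sub
      aestronglyMeasurable_const).enorm

theorem HasTraceAt.const_smul [NormedSpace ℝ V] {u : X → V} {x : X} {a : V}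
    (hu : HasTraceAt μ Ω u x a) (c : ℝ) : HasTraceAt μ Ω (c • u) x (c • a) := by
  have h := ENNReal.Tendsto.const_mul (a := ‖c‖ₑ) hu (Or.inr enorm_ne_top)
  rw [mul_zero] at h
  refine h.congr fun r => ?_
  simp only [setLAverage_eq]
  rw [← mul_div_assoc, ← lintegral_const_mul' _ _ enorm_ne_top]
  congr 2
  ext y
  rw [Pi.smul_apply, ← smul_sub, enorm_smul]

/-- The constant `‖a - b‖` is at most `‖u y - a‖ + ‖u y - b‖`, whose averages tend to zero. -/
theorem HasTraceAt.unique {u : X → V} (hum : AEStronglyMeasurable u (μ.restrict Ω)) {x : X}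
    {a b : V} (hpos : ∀ r > 0, μ (Metric.ball x r ∩ Ω) ≠ 0)
    (hfin : ∀ r > 0, μ (Metric.ball x r ∩ Ω) ≠ ∞)
    (ha : HasTraceAt μ Ω u x a) (hb : HasTraceAt μ Ω u x b) : a = b := by
  have h := Tendsto.add ha hb
  rw [add_zero] at h
  have hle : ‖a - b‖ₑ ≤ 0 := by
    refine ge_of_tendsto h ?_
    filter_upwards [self_mem_nhdsWithin] with r hr
    rw [← setLAverage_const (hpos r hr) (hfin r hr) ‖a - b‖ₑ]
    simp only [setLAverage_eq]
    rw [← ENNReal.add_div, ← lintegral_add_left']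
    · gcongr with y
      rw [← edist_eq_enorm_sub, ← edist_eq_enorm_sub, ← edist_eq_enorm_sub]
      exact edist_triangle_left _ _ _
    · exact ((hum.mono_measure (Measure.restrict_mono_set _ inter_subset_right)).sub
        aestronglyMeasurable_const).enorm
  exact sub_eq_zero.1 (enorm_eq_zero.1 (le_antisymm hle zero_le))

end TraceAlgebra

/-! ### The boundary of a bounded domain and the weighted measure. -/

section Domain

variable {X : Type*} [MetricSpace X] {Ω : Set X}

/-- A set with at most one point is closed, and an open and closed set has empty frontier. -/
theorem diam_pos_of_nonempty_frontier (hΩ : IsOpen Ω) (hΩb : Bornology.IsBounded Ω)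
    (hF : (frontier Ω).Nonempty) : 0 < Metric.diam Ω := by
  refine Metric.diam_pos ?_ hΩb
  by_contra hsub
  rw [not_nontrivial_iff] at hsub
  have hcl : IsClosed Ω := hsub.isClosed
  rw [hcl.frontier_eq, hΩ.interior_eq, sdiff_self] at hF
  exact not_nonempty_empty hF

theorem infDist_frontier_pos (hΩ : IsOpen Ω) (hF : (frontier Ω).Nonempty) {x : X} (hx : x ∈ Ω) :
    0 < Metric.infDist x (frontier Ω) := by
  refine (isClosed_frontier.notMem_iff_infDist_pos hF).1 fun hxF => ?_
  rw [hΩ.frontier_eq] at hxF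
  exact hxF.2 hx

/-- A Borel version of the density of `boundaryWeighted`. -/
noncomputable def boundaryDensity (Ω : Set X) (ω : ℝ → ℝ) (x : X) : ℝ≥0∞ :=
  ENNReal.ofReal ((Ioi (0 : ℝ)).indicator ω (Metric.infDist x (frontier Ω)))

theorem boundaryDensity_of_mem (hΩ : IsOpen Ω) (hF : (frontier Ω).Nonempty) (ω : ℝ → ℝ) {x : X}
    (hx : x ∈ Ω) :
    boundaryDensity Ω ω x = ENNReal.ofReal (ω (Metric.infDist x (frontier Ω))) := by
  rw [boundaryDensity, indicator_of_mem (mem_Ioi.2 (infDist_frontier_pos hΩ hF hx))]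

theorem one_le_mul_boundaryDensity (hΩ : IsOpen Ω) {ω : ℝ → ℝ} (hω_one : ∀ t > 0, 1 ≤ ω t)
    (hω : AntitoneOn ω (Ioi 0)) {x y : X} (hx : x ∈ Ω) (hy : y ∈ frontier Ω) {t : ℝ}
    (hxy : dist x y < t) : 1 ≤ ENNReal.ofReal (ω t)⁻¹ * boundaryDensity Ω ω x := by
  have hF : (frontier Ω).Nonempty := ⟨y, hy⟩
  have hd := infDist_frontier_pos hΩ hF hx
  have hlt : Metric.infDist x (frontier Ω) < t := (Metric.infDist_le_dist_of_mem hy).trans_lt hxy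
  have ht : 0 < t := hd.trans hlt
  have hωt : 0 < ω t := zero_lt_one.trans_le (hω_one t ht)
  rw [boundaryDensity_of_mem hΩ hF ω hx, ← ENNReal.ofReal_mul (by positivity),
    ENNReal.one_le_ofReal, ← div_eq_inv_mul, one_le_div hωt]
  exact hω hd ht hlt.le

variable [MeasurableSpace X] {μ : Measure X}

theorem measure_ne_top_of_isDoublingOn (h : IsDoublingOn μ Ω) (hΩb : Bornology.IsBounded Ω) :
    μ Ω ≠ ∞ := by
  obtain ⟨C, -, hC⟩ := h
  rcases Ω.eq_empty_or_nonempty with rfl | ⟨x, hx⟩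
  · simp
  · obtain ⟨r, hr, hsub⟩ := hΩb.subset_ball_lt 0 x
    have := (hC x (subset_closure hx) r hr).2.2
    rwa [inter_eq_self_of_subset_right hsub, lt_top_iff_ne_top] at this

variable [BorelSpace X]

theorem measurable_boundaryDensity (Ω : Set X) {ω : ℝ → ℝ} (hω : AntitoneOn ω (Ioi 0)) :
    Measurable (boundaryDensity Ω ω) :=
  ((measurable_indicator_of_antitoneOn hω).comp
    (Metric.continuous_infDist_pt _).measurable).ennreal_ofReal

theorem boundaryWeighted_restrict (hΩ : IsOpen Ω) (hF : (frontier Ω).Nonempty) (ω : ℝ → ℝ) :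
    (boundaryWeighted μ Ω ω).restrict Ω = (μ.restrict Ω).withDensity (boundaryDensity Ω ω) := by
  rw [boundaryWeighted, restrict_withDensity hΩ.measurableSet]
  refine withDensity_congr_ae ?_
  filter_upwards [ae_restrict_mem hΩ.measurableSet] with x hx
  exact (boundaryDensity_of_mem hΩ hF ω hx).symm

/-- Since the weight is at least 1, membership in the weighted `L^θ` gives membership in the
unweighted one, and then integrability on `Ω`. -/
theorem restrict_le_boundaryWeighted_restrict (hΩ : IsOpen Ω) (hF : (frontier Ω).Nonempty)
    {ω : ℝ → ℝ} (hω_one : ∀ t > 0, 1 ≤ ω t) :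
    μ.restrict Ω ≤ (boundaryWeighted μ Ω ω).restrict Ω := by
  rw [boundaryWeighted_restrict hΩ hF]
  conv_lhs => rw [← withDensity_one (μ := μ.restrict Ω)]
  refine withDensity_mono ?_
  filter_upwards [ae_restrict_mem hΩ.measurableSet] with x hx
  rw [boundaryDensity_of_mem hΩ hF ω hx, Pi.one_apply, ENNReal.one_le_ofReal]
  exact hω_one _ (infDist_frontier_pos hΩ hF hx)

theorem lintegral_boundaryWeighted (hΩ : IsOpen Ω) (hF : (frontier Ω).Nonempty) {ω : ℝ → ℝ}
    (hω : AntitoneOn ω (Ioi 0)) {f : X → ℝ≥0∞} (hf : Measurable f) :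
    ∫⁻ x in Ω, f x ∂(boundaryWeighted μ Ω ω) = ∫⁻ x in Ω, boundaryDensity Ω ω x * f x ∂μ := by
  rw [boundaryWeighted_restrict hΩ hF,
    lintegral_withDensity_eq_lintegral_mul _ (measurable_boundaryDensity Ω hω) hf]
  rfl

end Domain

/-! ### Verification of the abstract hypotheses and the norm bound. -/

section TraceOperator

variable {X : Type*} [MetricSpace X] [MeasurableSpace X] {μ : Measure X} {Ω : Set X}
  {H : Measure (frontier Ω)} {θ : ℝ}

theorem isFiniteMeasure_of_isUpperCodimRegular (hd : IsDoublingOn μ Ω)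
    (hΩb : Bornology.IsBounded Ω) (hdiam : 0 < Metric.diam Ω) (hH : IsUpperCodimRegular μ Ω H θ)
    (z : frontier Ω) : IsFiniteMeasure H := by
  obtain ⟨C, hC⟩ := hH
  obtain ⟨D, -, hD⟩ := hd
  refine ⟨?_⟩
  -- Larger than the diameter, so that one ball covers the whole boundary, yet below the bound `2 *
  -- diam Ω` for the regularity of `H`.
  set r : ℝ := 3 / 2 * Metric.diam Ω with hr
  have hr0 : 0 < r := by positivity
  have huniv : (univ : Set (frontier Ω)) ⊆ Metric.ball z r := by
    intro y _
    rw [Metric.mem_ball, Subtype.dist_eq]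
    have h := Metric.dist_le_diam_of_mem hΩb.closure (frontier_subset_closure y.2)
      (frontier_subset_closure z.2)
    rw [Metric.diam_closure] at h
    linarith
  refine (measure_mono huniv).trans_lt ((hC z r hr0 (by linarith)).trans_lt ?_)
  refine ENNReal.mul_lt_top ENNReal.coe_lt_top (ENNReal.div_lt_top
    (hD z (frontier_subset_closure z.2) r hr0).2.2.ne ?_)
  rw [ne_eq, ENNReal.ofReal_eq_zero, not_le]
  positivity

theorem HasTraceAt.unique_of_isDoublingOn (hd : IsDoublingOn μ Ω) {V : Type*} [NormedAddCommGroup V]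
    {u : X → V}
    (hum : AEStronglyMeasurable u (μ.restrict Ω)) {x : X} (hx : x ∈ closure Ω) {a b : V}
    (ha : HasTraceAt μ Ω u x a) (hb : HasTraceAt μ Ω u x b) : a = b := by
  obtain ⟨C, -, hC⟩ := hd
  refine ha.unique hum (fun r hr => ?_) (fun r hr => (hC x hx r hr).2.2.ne) hb
  have := (hC x hx (r / 2) (half_pos hr)).1
  rw [mul_div_cancel₀ r two_ne_zero] at this
  exact this.ne'

variable [BorelSpace X]

/-- The centre `y` need not lie on `∂Ω`, so its ball is enclosed in `B(z, 2t)` with `z ∈ ∂Ω`; hence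
the extra doubling constant, and the condition on `t₀` that keeps `2t` below `2 * diam Ω`. -/
theorem codimRegularUpTo_closureMeasure (hθ : 0 ≤ θ) {D : ℝ≥0}
    (hm : IsDoublingWith (closureMeasure μ Ω) D) {C : ℝ≥0}
    (hC : ∀ x : frontier Ω, ∀ r : ℝ, 0 < r → r < 2 * Metric.diam Ω →
      H (Metric.ball x r) ≤ C * (μ (Metric.ball (x : X) r ∩ Ω) / ENNReal.ofReal (r ^ θ)))
    {t₀ : ℝ} (ht₀ : t₀ < Metric.diam Ω) :
    IsDoublingWith.CodimRegularUpTo (closureMeasure μ Ω) H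
      (inclusion (frontier_subset_closure (s := Ω))) θ (C * D) t₀ := by
  intro t ht htt y z hyz
  have hsub : inclusion (frontier_subset_closure (s := Ω)) ⁻¹' Metric.ball y t ⊆
      Metric.ball z (2 * t) := by
    intro x hx
    have h1 : dist (inclusion (frontier_subset_closure (s := Ω)) x) y < t := hx
    have h2 := dist_triangle_right (inclusion (frontier_subset_closure (s := Ω)) x)
      (inclusion (frontier_subset_closure (s := Ω)) z) y
    have h3 : dist x z ≤ dist (inclusion (frontier_subset_closure (s := Ω)) x) y +
      dist (inclusion (frontier_subset_closure (s := Ω)) z) y := h2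
    rw [Metric.mem_ball]
    linarith
  have h1 := hC z (2 * t) (by positivity) (by linarith)
  have h2 := hm.doubling (inclusion frontier_subset_closure z) t ht
  rw [closureMeasure_ball, coe_inclusion] at h2
  refine (measure_mono hsub).trans (h1.trans ?_)
  calc (C : ℝ≥0∞) * (μ (Metric.ball (z : X) (2 * t) ∩ Ω) / ENNReal.ofReal ((2 * t) ^ θ))
      ≤ C * (D * closureMeasure μ Ω (Metric.ball (inclusion frontier_subset_closure z) t) /
          ENNReal.ofReal (t ^ θ)) := by
        gcongr
        linarith
    _ = _ := by simp only [div_eq_mul_inv]; ring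

variable {V : Type*} [NormedAddCommGroup V]

theorem normPoincareAt_of_isUpperGradient {C : ℝ≥0} {l : ℝ}
    (hP : ∀ u : X → ℝ, LocallyIntegrableOn u Ω μ → ∀ g : X → ℝ≥0∞, IsUpperGradient Ω u g →
      ∀ x ∈ Ω, ∀ r > 0, IntegrableOn u (Metric.ball x r ∩ Ω) μ →
      ⨍⁻ y in Metric.ball x r ∩ Ω, ‖u y - ⨍ z in Metric.ball x r ∩ Ω, u z ∂μ‖ₑ ∂μ ≤
        C * ENNReal.ofReal r * (⨍⁻ y in Metric.ball x (l * r) ∩ Ω, g y ^ θ ∂μ) ^ (1 / θ))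
    (hΩf : μ Ω ≠ ∞) {u : X → V} (hu : IntegrableOn u Ω μ) {g : X → ℝ≥0∞}
    (hg : IsUpperGradient Ω u g) {y : closure Ω} (hy : (y : X) ∈ Ω) :
    IsDoublingWith.NormPoincareAt (closureMeasure μ Ω) (fun y => u y) (fun y => g y ^ θ) θ C l
      y := by
  intro v r hr
  have hv : IntegrableOn (fun x => ‖u x - v‖) Ω μ := (hu.sub (integrableOn_const hΩf)).norm
  have h := hP _ hv.locallyIntegrableOn g (hg.norm_sub_const v) y hy r hr
    (hv.mono_set inter_subset_right)
  rw [mul_assoc] at h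
  rw [setAverage_closureMeasure (fun x => ‖u x - v‖),
    setLAverage_closureMeasure (fun x => g x ^ θ),
    setLAverage_closureMeasure
      (fun x => ‖‖u x - v‖ - ⨍ z in Metric.ball (y : X) r ∩ Ω, ‖u z - v‖ ∂μ‖ₑ)]
  exact h

/-- The gain from the weight: on `B(x, t) ∩ Ω` with `x ∈ ∂Ω` the density is at least `ω t`, as `ω`
is non-increasing. -/
theorem setLAverage_rpow_le_boundaryDensity (hΩ : IsOpen Ω) (hθ : 0 < θ) {ω : ℝ → ℝ}
    (hω_one : ∀ t > 0, 1 ≤ ω t) (hω : AntitoneOn ω (Ioi 0)) {G : X → ℝ≥0∞} (hG : Measurable G)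
    {x : X} (hx : x ∈ frontier Ω) {t : ℝ} (ht : 0 < t) :
    (⨍⁻ y in Metric.ball x t ∩ Ω, G y ∂μ) ^ (1 / θ) ≤ ENNReal.ofReal (ω t ^ (-1 / θ)) *
      (⨍⁻ y in Metric.ball x t ∩ Ω, boundaryDensity Ω ω y * G y ∂μ) ^ (1 / θ) := by
  have hωt : 0 < ω t := zero_lt_one.trans_le (hω_one t ht)
  have hθ1 : 0 ≤ 1 / θ := by positivity
  have hφ : ENNReal.ofReal (ω t ^ (-1 / θ)) = ENNReal.ofReal (ω t)⁻¹ ^ (1 / θ) := by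
    rw [ENNReal.ofReal_rpow_of_nonneg (by positivity) hθ1, Real.inv_rpow hωt.le,
      ← Real.rpow_neg hωt.le, neg_div]
  rw [hφ, ← ENNReal.mul_rpow_of_nonneg _ _ hθ1,
    ← setLAverage_const_mul (f := fun y => boundaryDensity Ω ω y * G y)
      ((measurable_boundaryDensity Ω hω).mul hG)]
  refine ENNReal.rpow_le_rpow ?_ hθ1
  rw [setLAverage_eq, setLAverage_eq]
  refine ENNReal.div_le_div_right (setLIntegral_mono'
    (Metric.isOpen_ball.inter hΩ).measurableSet fun y hy => ?_) _
  rw [← mul_assoc]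
  exact le_mul_of_one_le_left zero_le (one_le_mul_boundaryDensity hΩ hω_one hω hy.2 hx hy.1)

variable [NormedSpace ℝ V] [CompleteSpace V]

/-- The trace of a function with a given upper gradient, with a norm bound. -/
theorem exists_trace_of_isUpperGradient (hΩ : IsOpen Ω) (hΩb : Bornology.IsBounded Ω)
    (hF : (frontier Ω).Nonempty) (hθ : 1 < θ) (hadm : IsWeaklyAdmissible μ Ω H θ) {ω : ℝ → ℝ}
    (hω_one : ∀ t > 0, 1 ≤ ω t) (hω_anti : AntitoneOn ω (Ioi 0))
    (hω_int : ∫⁻ t in Ioo (0 : ℝ) 1, ENNReal.ofReal (t⁻¹ * ω t ^ (-1 / θ)) < ∞) :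
    ∃ A B : ℝ≥0, ∀ u : X → V,
      MemLp u (ENNReal.ofReal θ) ((boundaryWeighted μ Ω ω).restrict Ω) →
      ∀ g : X → ℝ≥0∞, IsUpperGradient Ω u g → ∫⁻ x in Ω, g x ^ θ ∂(boundaryWeighted μ Ω ω) ≠ ∞ →
      ∃ f : frontier Ω → V, AEStronglyMeasurable f H ∧
        (∀ᵐ x : frontier Ω ∂H, HasTraceAt μ Ω u x (f x)) ∧
        eLpNorm f (ENNReal.ofReal θ) H ≤
          A * eLpNorm u (ENNReal.ofReal θ) ((boundaryWeighted μ Ω ω).restrict Ω) +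
          B * (∫⁻ x in Ω, g x ^ θ ∂(boundaryWeighted μ Ω ω)) ^ (1 / θ) := by
  have hθ0 : 0 < θ := by linarith
  have hθ1 : 0 ≤ 1 / θ := by positivity
  have hofReal0 : ENNReal.ofReal θ ≠ 0 := by simpa using hθ0
  have hdiam := diam_pos_of_nonempty_frontier hΩ hΩb hF
  have hμΩ := measure_ne_top_of_isDoublingOn hadm.doubling hΩb
  have := isFiniteMeasure_of_isUpperCodimRegular hadm.doubling hΩb hdiam hadm.upperCodim
    ⟨hF.some, hF.some_mem⟩
  obtain ⟨D, -, hD⟩ := hadm.doubling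
  obtain ⟨K, hK⟩ := hadm.upperCodim
  obtain ⟨CP, -, l, hl, hP⟩ := hadm.poincare
  set m := closureMeasure μ Ω with hm_def
  have hm : IsDoublingWith m D := isDoublingWith_closureMeasure hD
  have hmf : IsFiniteMeasure m := isFiniteMeasure_closureMeasure hμΩ
  have hsc : SecondCountableTopology (closure Ω) :=
    secondCountableTopology_of_measure_ball_ne_zero m hm.pos
  -- The bound `1 / 2` is for the dyadic Dini sum, `diam Ω / 2` for the codimension bound.
  set t₀ : ℝ := min (1 / 2) (Metric.diam Ω / 2) with ht₀_def
  have ht₀ : 0 < t₀ := by positivity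
  have ht₀1 : t₀ ≤ 1 / 2 := min_le_left _ _
  have ht₀2 : t₀ < Metric.diam Ω := (min_le_right _ _).trans_lt (by linarith)
  have hHreg : IsDoublingWith.CodimRegularUpTo m H
      (inclusion (frontier_subset_closure (s := Ω))) θ ((K * D : ℝ≥0) : ℝ≥0∞) t₀ := by
    rw [ENNReal.coe_mul]
    exact codimRegularUpTo_closureMeasure hθ0.le hm hK ht₀2
  have hφ := tsum_dyadic_ne_top hθ0 hω_one hω_anti hω_int ht₀ ht₀1
  obtain ⟨P, N, hPN⟩ := hm.exists_banach_poincare (V := V) hθ CP (zero_lt_one.trans_le hl)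
  set A : ℝ≥0∞ := ((K * D : ℝ≥0) / ENNReal.ofReal ((t₀ / 2 ^ N) ^ θ)) ^ (1 / θ) with hA_def
  have hA : A ≠ ∞ := by
    refine ENNReal.rpow_ne_top_of_nonneg hθ1 (ENNReal.div_lt_top ENNReal.coe_ne_top ?_).ne
    rw [ne_eq, ENNReal.ofReal_eq_zero, not_le]
    positivity
  set B : ℝ≥0∞ := D * (P * ((∑' k : ℕ, ENNReal.ofReal (ω (t₀ / 2 ^ k) ^ (-1 / θ))) *
      ((K * D : ℝ≥0) : ℝ≥0∞) ^ (1 / θ))) with hB_def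
  have hB : B ≠ ∞ :=
    ENNReal.mul_ne_top ENNReal.coe_ne_top (ENNReal.mul_ne_top ENNReal.coe_ne_top
      (ENNReal.mul_ne_top hφ (ENNReal.rpow_ne_top_of_nonneg hθ1 ENNReal.coe_ne_top)))
  refine ⟨A.toNNReal, B.toNNReal, fun u hu g hg hgf => ?_⟩
  have hle := restrict_le_boundaryWeighted_restrict (μ := μ) hΩ hF hω_one
  have hu' : MemLp u (ENNReal.ofReal θ) (μ.restrict Ω) := hu.mono_measure hle
  have : IsFiniteMeasure (μ.restrict Ω) := ⟨by simpa using hμΩ.lt_top⟩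
  have hui : IntegrableOn u Ω μ := hu'.integrable (by simpa using hθ.le)
  have hgθ : Measurable fun x => g x ^ θ := hg.1.pow_const θ
  have hGm : Measurable fun x => boundaryDensity Ω ω x * g x ^ θ :=
    (measurable_boundaryDensity Ω hω_anti).mul hgθ
  have hG' : ∫⁻ y, boundaryDensity Ω ω y * g y ^ θ ∂m =
      ∫⁻ x in Ω, g x ^ θ ∂(boundaryWeighted μ Ω ω) := by
    rw [lintegral_boundaryWeighted hΩ hF hω_anti hgθ,
      lintegral_closureMeasure fun x => boundaryDensity Ω ω x * g x ^ θ]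
  have hae : ∀ᵐ y : closure Ω ∂m, (y : X) ∈ Ω :=
    ae_closureMeasure.2 (ae_restrict_mem hΩ.measurableSet)
  have hPu := hPN (fun y => u y) (fun y => g y ^ θ) (integrable_closureMeasure hui)
    (hgθ.comp measurable_subtype_coe)
    (hae.mono fun y hy => normPoincareAt_of_isUpperGradient hP hμΩ hui hg hy)
  obtain ⟨f, hfm, hft, hfn⟩ := hm.exists_trace
    (measurable_inclusion (frontier_subset_closure (s := Ω))) hθ ht₀ hHreg
    (φ := fun t => ENNReal.ofReal (ω t ^ (-1 / θ))) hφ (integrable_closureMeasure hui)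
    (G' := fun y => boundaryDensity Ω ω y * g y ^ θ) (hGm.comp measurable_subtype_coe)
    (hG'.trans_ne hgf) hPu (fun z t ht _ => by
      rw [setLAverage_closureMeasure fun x => g x ^ θ,
        setLAverage_closureMeasure fun x => boundaryDensity Ω ω x * g x ^ θ]
      exact setLAverage_rpow_le_boundaryDensity hΩ hθ0 hω_one hω_anti hgθ z.2 ht)
  refine ⟨f, hfm, ?_, ?_⟩
  · filter_upwards [hft] with z hz
    refine hz.congr fun r => ?_
    rw [setLAverage_closureMeasure fun x => ‖u x - f z‖ₑ]
  · have hun : (∫⁻ y : closure Ω, ‖u y‖ₑ ^ θ ∂m) ^ (1 / θ) ≤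
        eLpNorm u (ENNReal.ofReal θ) ((boundaryWeighted μ Ω ω).restrict Ω) := by
      rw [lintegral_closureMeasure fun x => ‖u x‖ₑ ^ θ]
      refine le_trans (le_of_eq ?_) (eLpNorm_mono_measure u hle)
      rw [eLpNorm_eq_lintegral_rpow_enorm_toReal hofReal0 ENNReal.ofReal_ne_top,
        ENNReal.toReal_ofReal hθ0.le]
    rw [eLpNorm_eq_lintegral_rpow_enorm_toReal hofReal0 ENNReal.ofReal_ne_top,
      ENNReal.toReal_ofReal hθ0.le]
    rw [hG'] at hfn
    refine hfn.trans (add_le_add (mul_le_mul' (ENNReal.coe_toNNReal hA).ge hun) ?_)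
    rw [ENNReal.coe_toNNReal hB, hB_def]
    simp only [mul_assoc]
    exact le_rfl

/-- Every `u` in the weighted Sobolev space has a trace in `L^θ`, bounded by its norm. -/
theorem exists_Lp_trace [hθ : Fact (1 < θ)] (hΩ : IsOpen Ω) (hΩb : Bornology.IsBounded Ω)
    (hF : (frontier Ω).Nonempty) (hadm : IsWeaklyAdmissible μ Ω H θ) {ω : ℝ → ℝ}
    (hω_one : ∀ t > 0, 1 ≤ ω t) (hω_anti : AntitoneOn ω (Ioi 0))
    (hω_int : ∫⁻ t in Ioo (0 : ℝ) 1, ENNReal.ofReal (t⁻¹ * ω t ^ (-1 / θ)) < ∞) :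
    ∃ M : ℝ, ∀ u : PreSobolev Ω V θ (boundaryWeighted μ Ω ω), ∃ f : Lp V (ENNReal.ofReal θ) H,
      (∀ᵐ x : frontier Ω ∂H, HasTraceAt μ Ω u.toFun x (f x)) ∧ ‖f‖ ≤ M * ‖u‖ := by
  have hθ0 : 0 < θ := zero_lt_one.trans hθ.out
  obtain ⟨A, B, hAB⟩ := exists_trace_of_isUpperGradient (V := V) hΩ hΩb hF hθ.out hadm hω_one
    hω_anti hω_int
  refine ⟨max A B, fun u => ?_⟩
  have hu : MemLp u.toFun (ENNReal.ofReal θ) ((boundaryWeighted μ Ω ω).restrict Ω) := u.2.1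
  have hum : AEStronglyMeasurable u.toFun (μ.restrict Ω) :=
    hu.1.mono_measure (restrict_le_boundaryWeighted_restrict hΩ hF hω_one)
  have hdir := u.dirichletSeminorm_ne_top
  set U := eLpNorm u.toFun (ENNReal.ofReal θ) ((boundaryWeighted μ Ω ω).restrict Ω) with hU
  set E := dirichletSeminorm Ω θ (boundaryWeighted μ Ω ω) u.toFun with hE
  have hbd : ∀ ε : ℝ≥0∞, ε ≠ 0 → ε ≠ ∞ → ∃ f : frontier Ω → V, AEStronglyMeasurable f H ∧
      (∀ᵐ x : frontier Ω ∂H, HasTraceAt μ Ω u.toFun x (f x)) ∧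
      eLpNorm f (ENNReal.ofReal θ) H ≤ A * U + B * (E + ε) := by
    intro ε hε hεt
    obtain ⟨g, hg, hgl⟩ := exists_isUpperGradient_le_dirichletSeminorm_add hθ.out hdir hε
    have hgf : ∫⁻ x in Ω, g x ^ θ ∂(boundaryWeighted μ Ω ω) ≠ ∞ := by
      intro h
      rw [h, ENNReal.top_rpow_of_pos (by positivity), top_le_iff] at hgl
      exact ENNReal.add_ne_top.2 ⟨hdir, hεt⟩ hgl
    obtain ⟨f, hfm, hft, hfn⟩ := hAB u.toFun hu g hg hgf
    exact ⟨f, hfm, hft, hfn.trans (by gcongr)⟩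
  obtain ⟨f, hfm, hft, hf1⟩ := hbd 1 one_ne_zero ENNReal.one_ne_top
  -- The function `f` comes from one upper gradient, but by uniqueness of traces it agrees almost
  -- everywhere with the trace obtained from any better one, so `ε` may tend to zero. Dividing by `B
  -- + 1` avoids the case `B = 0`.
  have hfn : eLpNorm f (ENNReal.ofReal θ) H ≤ A * U + B * E := by
    refine ENNReal.le_of_forall_pos_le_add fun ε hε _ => ?_
    have hB1 : ((B + 1 : ℝ≥0) : ℝ≥0∞) ≠ 0 := by simp
    obtain ⟨f', -, hft', hfn'⟩ := hbd (ε / (B + 1 : ℝ≥0))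
      (ENNReal.div_pos (by exact_mod_cast hε.ne') ENNReal.coe_ne_top).ne'
      (ENNReal.div_lt_top ENNReal.coe_ne_top hB1).ne
    have heq : f =ᵐ[H] f' := by
      filter_upwards [hft, hft'] with x hx hx'
      exact hx.unique_of_isDoublingOn hadm.doubling hum (frontier_subset_closure x.2) hx'
    rw [eLpNorm_congr_ae heq]
    refine hfn'.trans ?_
    rw [mul_add, ← add_assoc]
    gcongr
    calc (B : ℝ≥0∞) * (ε / (B + 1 : ℝ≥0)) ≤ (B + 1 : ℝ≥0) * (ε / (B + 1 : ℝ≥0)) := by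
          gcongr
          exact le_self_add
      _ = ε := ENNReal.mul_div_cancel hB1 ENNReal.coe_ne_top
  have hfin : A * U + B * E ≠ ∞ := ENNReal.add_ne_top.2
    ⟨ENNReal.mul_ne_top ENNReal.coe_ne_top hu.eLpNorm_ne_top,
      ENNReal.mul_ne_top ENNReal.coe_ne_top hdir⟩
  have hfL : MemLp f (ENNReal.ofReal θ) H := ⟨hfm, hfn.trans_lt hfin.lt_top⟩
  refine ⟨hfL.toLp f, ?_, ?_⟩
  · filter_upwards [hft, hfL.coeFn_toLp] with x hx hx'
    rwa [hx']
  · rw [Lp.norm_toLp, PreSobolev.norm_def, mul_add]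
    have h := ENNReal.toReal_mono hfin hfn
    rw [ENNReal.toReal_add (ENNReal.mul_ne_top ENNReal.coe_ne_top hu.eLpNorm_ne_top)
      (ENNReal.mul_ne_top ENNReal.coe_ne_top hdir), ENNReal.toReal_mul, ENNReal.toReal_mul,
      ENNReal.coe_toReal, ENNReal.coe_toReal] at h
    refine h.trans (add_le_add ?_ ?_)
    · exact mul_le_mul_of_nonneg_right (le_max_left _ _) ENNReal.toReal_nonneg
    · exact mul_le_mul_of_nonneg_right (le_max_right _ _) ENNReal.toReal_nonneg

end TraceOperator

theorem theorem5p1 {X : Type*} [MetricSpace X] [CompleteSpace X] [MeasurableSpace X] [BorelSpace X]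
    (μ : Measure X) (Ω : Set X) (hΩ : IsOpen Ω) (hΩc : IsConnected Ω)
    (hΩb : Bornology.IsBounded Ω) (H : Measure (frontier Ω)) [SigmaFinite H]
    {V : Type*} [NormedAddCommGroup V] [NormedSpace ℝ V] [CompleteSpace V]
    (θ : ℝ) [Fact (1 < θ)] (hadm : IsWeaklyAdmissible μ Ω H θ)
    (ω : ℝ → ℝ) (hω_one : ∀ t > 0, 1 ≤ ω t) (hω_anti : AntitoneOn ω (Set.Ioi 0))
    (hω_int : ∫⁻ t in Set.Ioo (0 : ℝ) 1, ENNReal.ofReal (t⁻¹ * ω t ^ (-1 / θ)) < ∞) :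
    ∃ T : Sobolev Ω V θ (boundaryWeighted μ Ω ω) →L[ℝ] Lp V (ENNReal.ofReal θ) H,
      ∀ u : PreSobolev Ω V θ (boundaryWeighted μ Ω ω),
        ∀ᵐ x : frontier Ω ∂H, HasTraceAt μ Ω u.toFun x (T (SeparationQuotient.mk u) x) := by
  rcases (frontier Ω).eq_empty_or_nonempty with hF | hF
  -- Without boundary points the claim is void and any operator serves.
  · have : IsEmpty (frontier Ω) := isEmpty_coe_sort.2 hF
    exact ⟨0, fun u => Eventually.of_forall fun x => isEmptyElim x⟩
  obtain ⟨M, hM⟩ := exists_Lp_trace (V := V) hΩ hΩb hF hadm hω_one hω_anti hω_int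
  choose F hFt hFn using hM
  have hum : ∀ u : PreSobolev Ω V θ (boundaryWeighted μ Ω ω),
      AEStronglyMeasurable u.toFun (μ.restrict Ω) := fun u =>
    u.2.1.1.mono_measure (restrict_le_boundaryWeighted_restrict hΩ hF hω_one)
  -- The traces are picked by choice for each `u`; linearity follows because sums and multiples of
  -- traces are traces, and these are unique.
  let L : PreSobolev Ω V θ (boundaryWeighted μ Ω ω) →ₗ[ℝ] Lp V (ENNReal.ofReal θ) H :=
    { toFun := F
      map_add' := fun u v => by
        refine Lp.ext ?_
        filter_upwards [hFt u, hFt v, hFt (u + v), Lp.coeFn_add (F u) (F v)] with x hu hv huv hx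
        rw [hx, Pi.add_apply]
        exact huv.unique_of_isDoublingOn hadm.doubling (hum (u + v))
          (frontier_subset_closure x.2) (hu.add (hum u) hv)
      map_smul' := fun c u => by
        refine Lp.ext ?_
        filter_upwards [hFt u, hFt (c • u), Lp.coeFn_smul c (F u)] with x hu hcu hx
        rw [RingHom.id_apply, hx, Pi.smul_apply]
        exact hcu.unique_of_isDoublingOn hadm.doubling (hum (c • u))
          (frontier_subset_closure x.2) (hu.const_smul c) }
  let L' := L.mkContinuous M hFn
  -- Functions at distance zero are inseparable, and a continuous map into a Hausdorff space
  -- identifies their images.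
  exact ⟨SeparationQuotient.liftCLM L' fun x y hxy => (hxy.map L'.continuous).eq, hFt⟩
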